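/- Let $\mu$ and $\nu$ be Borel probability measures on $\mathbb{C}$ with compact support, and assume that $\mu$ is not supported on a circle, i.e. there are no $z\in\mathbb{C}$ and $r\ge 0$ with $\operatorname{supp}\mu\subset\{w\in\mathbb{C}:|w-z|=r\}$ (there is no such assumption on $\nu$). For a compactly supported probability measure $\mu$, let $U_\mu(z)=\int_{\mathbb{C}}\log|z-w|\,d\mu(w)\in[-\infty,\infty)$, $z\in\mathbb{C}$, be its logarithmic potential, and put $U=\max\{U_\mu,U_\nu\}$. Then $U$ is finite almost everywhere and locally integrable with respect to Lebesgue measure $\lambda$ on $\mathbb{C}$, and there exists a (deterministic) probability measure $\rho$ on $\mathbb{C}$, depending only on $\mu$ and $\nu$, such that the following hold. (a) $\rho=\frac1{2\pi}\Delta U$ in the sense of distributions, i.e. $$\int_{\mathbb{C}}\varphi\,d\rho=\frac1{2\pi}\int_{\mathbb{C}}\Delta\varphi(z)\,U(z)\,d\lambda(z)\qquad\text{for all }\varphi\in C_c^\infty(\mathbb{C}),$$ where $C_c^\infty(\mathbb{C})$ is the set of smooth compactly supported functions $\mathbb{C}\to\mathbb{C}$; and $\rho$ is the only locally finite Borel measure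 on $\mathbb{C}$ (in particular, the only probability measure) with this property. (b) Let $X_1,Y_1,X_2,Y_2,\ldots$ be independent complex random variables, defined on any probability space, such that every $X_i$ has distribution $\mu$ and every $Y_i$ has distribution $\nu$. For $n\ge1$ let $$p_n(z)=\prod_{i=1}^n(z-X_i),\qquad q_n(z)=\prod_{i=1}^n(z-Y_i),$$ and let $z_1^{(n)},\ldots,z_n^{(n)}$ be the zeros of $p_n+q_n$, counted with multiplicity. Then for every $\varphi\in C_c^\infty(\mathbb{C})$, $$\frac1n\sum_{i=1}^n\varphi\bigl(z_i^{(n)}\bigr)\longrightarrow\int_{\mathbb{C}}\varphi\,d\rho\qquad\text{in probability as }n\to\infty.$$ -/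

import Mathlib

open MeasureTheory ProbabilityTheory Filter
open scoped ContDiff ENNReal

noncomputable section

/-- The logarithmic potential `U_μ(z) = ∫ log |z - w| dμ(w)`, with values in the extended reals:
`log 0 = -∞`, and the integral is the integral of the positive part of `log |z - w|` minus the
integral of its negative part. For a compactly supported finite measure the first of these is
finite, so the value is in `[-∞, ∞)`. -/
def logPotential (μ : Measure ℂ) (z : ℂ) : EReal :=
  ((∫⁻ w, (ENNReal.log ‖z - w‖ₑ).toENNReal ∂μ : ℝ≥0∞) : EReal) -
    ((∫⁻ w, (-ENNReal.log ‖z - w‖ₑ).toENNReal ∂μ : ℝ≥0∞) : EReal)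

/-- The support of `μ` lies in a circle `{w : |w - z| = r}`, where the radius `r = 0` is allowed. -/
def SupportedOnCircle (μ : Measure ℂ) : Prop :=
  ∃ (z : ℂ) (r : ℝ), 0 ≤ r ∧ μ.support ⊆ {w : ℂ | ‖w - z‖ = r}

/-- `ρ = (1 / 2π) Δ U` in the sense of distributions on `ℂ`, for an extended real valued function
`U`. It is part of the definition that `U` is finite almost everywhere and locally integrable with
respect to Lebesgue measure, so that `U` is a distribution and the integral on the right is a
genuine one. -/
def IsDistributionalLaplacian (ρ : Measure ℂ) (U : ℂ → EReal) : Prop :=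
  (∀ᵐ z : ℂ, U z ≠ ⊥ ∧ U z ≠ ⊤) ∧
  LocallyIntegrable (fun z : ℂ => (U z).toReal) ∧
  ∀ φ : ℂ → ℂ, ContDiff ℝ ∞ φ → HasCompactSupport φ →
    ∫ z, φ z ∂ρ =
      (1 / (2 * (Real.pi : ℂ))) * ∫ z : ℂ, Laplacian.laplacian φ z * (((U z).toReal : ℝ) : ℂ)

/-- The monic polynomial `∏_{i < n} (z - x_i)`. -/
def polyOfRoots (x : ℕ → ℂ) (n : ℕ) : Polynomial ℂ :=
  ∏ i ∈ Finset.range n, (Polynomial.X - Polynomial.C (x i))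

/-- The average `(1 / n) ∑ φ(z_i)` over the zeros `z_i` of `f`, repeated according to multiplicity;
it is used for polynomials `f` of degree `n`. -/
def zeroAverage (φ : ℂ → ℂ) (n : ℕ) (f : Polynomial ℂ) : ℂ :=
  (1 / (n : ℂ)) * (f.roots.map φ).sum

end

/-!
Write `V_μ(z) = ∫ log |z - w| dμ(w)` and `f_n = p_n + q_n`, a polynomial of degree `n` with leading
coefficient `2`. Since `(1 / 2π) log |z|` is the fundamental solution of the Laplacian
(`integral_laplacian_mul_log_norm_sub`), the zero average of a test function `φ` equals
`(1 / 2π) ∫ Δφ u_n`, where `u_n = (1 / n) (log |f_n| - log 2)` (`zeroAverage_eq_integral`). It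
remains to see that `u_n` converges to `max V_μ V_ν` as a distribution, in probability.

*At a fixed point.* For almost every `z` the function `log |z - ·|` is square integrable for both
measures. By the law of large numbers `(1 / n) log |p_n(z)|` and `(1 / n) log |q_n(z)|` converge to
`V_μ(z)` and `V_ν(z)`. The sum `p_n(z) + q_n(z)` can be much smaller than its larger term only if
`log |p_n(z)| - log |q_n(z)|` is bounded. This difference is a random walk, whose steps are
nondegenerate because `μ` does not live on a circle around `z`, so by the central limit theorem it
is unlikely to lie in a fixed bounded interval (`tendsto_measure_abs_sum_le_one`). Hence `u_n(z)`
converges in probability (`tendstoInMeasure_sumPotential`).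

*Integration.* By Fubini's theorem, every subsequence has a further subsequence along which, almost
surely, `u_n(z)` converges for almost every `z`. All `X_i` and `Y_i` lie in one disc, so `u_n` is
bounded above on discs, and its negative part is dominated by an average of translates of the
integrable function `max (-log |z|) 0`. This gives uniform integrability
(`unifIntegrable_averageLog`), and Vitali's theorem yields convergence against continuous functions
of compact support (`tendsto_integral_mul_averageLog`). As the exceptional event does not depend on
the test function, convergence in probability follows from the subsequence criterion.

*The limiting measure.* By Jensen's formula the zeros of `f_n` have bounded average of `log⁺ |w|`
(`sum_posLog_roots_le`), so along one realisation of the random variables their empirical measures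
are tight, and Prokhorov's theorem provides a probability measure `ρ` that represents the limit
(`exists_isProbabilityMeasure_integral_eq`). Uniqueness holds since smooth functions approximate the
indicators of bounded open sets from below (`measure_ext_of_integral_contDiff`).
-/

open Metric Topology

/-! ### Integrability of the logarithm -/

theorem integrableOn_ball_log_norm_sq (r : ℝ) :
    IntegrableOn (fun z : ℂ => (Real.log ‖z‖) ^ 2) (ball 0 r) := by
  rw [integrableOn_fun_norm_addHaar volume (f := fun y => (Real.log y) ^ 2)]
  -- In polar coordinates the integrand is `y log² y = 4 (√y log √y)²`, continuous up to `0`.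
  have hc : Continuous fun y : ℝ => 4 * (√y * Real.log √y) ^ 2 := by
    have := Real.continuous_mul_log.comp Real.continuous_sqrt
    exact continuous_const.mul (this.pow 2)
  refine ((hc.integrableOn_Icc (a := 0) (b := r)).mono_set Set.Ioo_subset_Icc_self).congr_fun
    (fun y hy => ?_) measurableSet_Ioo
  have hy0 : 0 < y := hy.1
  simp only [Complex.finrank_real_complex, smul_eq_mul]
  rw [mul_pow, Real.sq_sqrt hy0.le, Real.log_sqrt hy0.le]
  ring

theorem integrableOn_ball_log_norm (r : ℝ) :
    IntegrableOn (fun z : ℂ => Real.log ‖z‖) (ball 0 r) := by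
  have h1 : IntegrableOn (fun z : ℂ => 1 + (Real.log ‖z‖) ^ 2) (ball 0 r) :=
    (integrableOn_const measure_ball_lt_top.ne).add (integrableOn_ball_log_norm_sq r)
  refine h1.mono' (by fun_prop : Measurable fun z : ℂ => Real.log ‖z‖).aestronglyMeasurable
    (Eventually.of_forall fun z => ?_)
  rw [Real.norm_eq_abs]
  nlinarith [sq_nonneg (|Real.log ‖z‖| - 1), sq_abs (Real.log ‖z‖), abs_nonneg (Real.log ‖z‖)]

/-- The translates `z ↦ log² |z - w|`, for `w` in a fixed ball, are integrable over a ball,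
with a bound independent of `w`. -/
theorem integral_ball_log_norm_sub_sq_le {r s : ℝ} {w : ℂ} (hw : ‖w‖ ≤ s) :
    IntegrableOn (fun z : ℂ => (Real.log ‖z - w‖) ^ 2) (ball 0 r) ∧
      ∫ z in ball (0 : ℂ) r, (Real.log ‖z - w‖) ^ 2 ≤
        ∫ z in ball (0 : ℂ) (r + s), (Real.log ‖z‖) ^ 2 := by
  have hmp := measurePreserving_sub_right (volume : Measure ℂ) w
  have hsub : ball (0 : ℂ) r ⊆ (fun z => z - w) ⁻¹' ball 0 (r + s) := by
    intro z hz
    simp only [Set.mem_preimage, mem_ball_zero_iff] at hz ⊢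
    linarith [norm_sub_le z w]
  have hemb : MeasurableEmbedding (fun z : ℂ => z - w) :=
    (MeasurableEquiv.subRight w).measurableEmbedding
  have hint : IntegrableOn (fun z : ℂ => (Real.log ‖z - w‖) ^ 2)
      ((fun z => z - w) ⁻¹' ball 0 (r + s)) :=
    (hmp.integrableOn_comp_preimage hemb (f := fun z : ℂ => (Real.log ‖z‖) ^ 2)).2
      (integrableOn_ball_log_norm_sq (r + s))
  refine ⟨hint.mono_set hsub, ?_⟩
  rw [← hmp.setIntegral_preimage_emb hemb (fun z : ℂ => (Real.log ‖z‖) ^ 2)]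
  exact setIntegral_mono_set hint (Eventually.of_forall fun z => sq_nonneg _)
    (LE.le.eventuallyLE hsub)

theorem integrable_prod_log_norm_sub_sq {μ : Measure ℂ} [IsProbabilityMeasure μ] {s : ℝ}
    (hμ : ∀ᵐ w ∂μ, ‖w‖ ≤ s) (r : ℝ) :
    Integrable (fun p : ℂ × ℂ => (Real.log ‖p.1 - p.2‖) ^ 2)
      ((volume.restrict (ball 0 r)).prod μ) := by
  have hm : Measurable fun p : ℂ × ℂ => (Real.log ‖p.1 - p.2‖) ^ 2 := by fun_prop
  rw [integrable_prod_iff' hm.aestronglyMeasurable]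
  refine ⟨hμ.mono fun w hw => (integral_ball_log_norm_sub_sq_le hw).1, ?_⟩
  refine Integrable.of_bound
    (hm.norm.stronglyMeasurable.integral_prod_left).aestronglyMeasurable
    (∫ z in ball (0 : ℂ) (r + s), (Real.log ‖z‖) ^ 2) (hμ.mono fun w hw => ?_)
  rw [Real.norm_of_nonneg (integral_nonneg fun _ => norm_nonneg _)]
  simpa using (integral_ball_log_norm_sub_sq_le (r := r) hw).2

theorem integrable_prod_log_norm_sub {μ : Measure ℂ} [IsProbabilityMeasure μ] {s : ℝ}
    (hμ : ∀ᵐ w ∂μ, ‖w‖ ≤ s) (r : ℝ) :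
    Integrable (fun p : ℂ × ℂ => Real.log ‖p.1 - p.2‖)
      ((volume.restrict (ball 0 r)).prod μ) := by
  have hm : Measurable fun p : ℂ × ℂ => Real.log ‖p.1 - p.2‖ := by fun_prop
  have : IsFiniteMeasure ((volume : Measure ℂ).restrict (ball 0 r)) :=
    isFiniteMeasure_restrict.2 measure_ball_lt_top.ne
  refine ((integrable_prod_log_norm_sub_sq hμ r).add (integrable_const (1 : ℝ))).mono'
    hm.aestronglyMeasurable (Eventually.of_forall fun p => ?_)
  rw [Real.norm_eq_abs, Pi.add_apply]
  nlinarith [sq_nonneg (|Real.log ‖p.1 - p.2‖| - 1), sq_abs (Real.log ‖p.1 - p.2‖),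
    abs_nonneg (Real.log ‖p.1 - p.2‖)]

/-! ### The logarithmic potential as a real function -/

/-- The real valued logarithmic potential `∫ log |z - w| dμ(w)`, with the junk value `log 0 = 0`
and the value `0` where the integral diverges; it agrees with `logPotential` at regular points. -/
noncomputable def realPotential (μ : Measure ℂ) (z : ℂ) : ℝ := ∫ w, Real.log ‖z - w‖ ∂μ

/-- `z` is regular for `μ` if it is not an atom and `log |z - ·|` is square integrable. -/
def IsRegularPoint (μ : Measure ℂ) (z : ℂ) : Prop :=
  μ {z} = 0 ∧ MemLp (fun w => Real.log ‖z - w‖) 2 μ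

theorem ae_norm_le_of_isCompact_support {μ : Measure ℂ} (hμ : IsCompact μ.support) :
    ∃ s : ℝ, 0 ≤ s ∧ ∀ᵐ w ∂μ, ‖w‖ ≤ s := by
  obtain ⟨s, hs⟩ := hμ.isBounded.exists_norm_le
  refine ⟨max s 0, le_max_right _ _, ?_⟩
  filter_upwards [Measure.support_mem_ae (μ := μ)] with w hw
  exact (hs w hw).trans (le_max_left _ _)

theorem ae_measure_singleton_eq_zero (μ : Measure ℂ) [SFinite μ] :
    ∀ᵐ z : ℂ, μ {z} = 0 := by
  have hd : MeasurableSet {p : ℂ × ℂ | p.1 = p.2} :=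
    measurableSet_eq_fun measurable_fst measurable_snd
  have h : ((volume : Measure ℂ).prod μ) {p : ℂ × ℂ | p.1 = p.2} = 0 := by
    rw [Measure.prod_apply_symm hd]
    have (w : ℂ) : (fun z : ℂ => (z, w)) ⁻¹' {p : ℂ × ℂ | p.1 = p.2} = {w} := by
      ext; simp
    simp [this]
  have h2 := (Measure.measure_prod_null hd).1 h
  filter_upwards [h2] with z hz
  have : Prod.mk z ⁻¹' {p : ℂ × ℂ | p.1 = p.2} = {z} := by
    ext w; simp [eq_comm]
  simpa [this] using hz

theorem ae_of_forall_ball {p : ℂ → Prop}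
    (h : ∀ k : ℕ, ∀ᵐ z ∂((volume : Measure ℂ).restrict (ball 0 k)), p z) :
    ∀ᵐ z : ℂ, p z := by
  have h2 : ∀ k : ℕ, ∀ᵐ z : ℂ, z ∈ ball (0 : ℂ) k → p z :=
    fun k => (ae_restrict_iff' measurableSet_ball).1 (h k)
  filter_upwards [ae_all_iff.2 h2] with z hz
  obtain ⟨k, hk⟩ := exists_nat_gt ‖z‖
  exact hz k (by simpa using hk)

theorem ae_isRegularPoint {μ : Measure ℂ} [IsProbabilityMeasure μ] {s : ℝ}
    (hμ : ∀ᵐ w ∂μ, ‖w‖ ≤ s) : ∀ᵐ z : ℂ, IsRegularPoint μ z := by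
  refine (ae_measure_singleton_eq_zero μ).and (ae_of_forall_ball fun k => ?_)
  filter_upwards [(integrable_prod_log_norm_sub_sq hμ k).prod_right_ae] with z hz
  exact (memLp_two_iff_integrable_sq
    (by fun_prop : Measurable fun w : ℂ => Real.log ‖z - w‖).aestronglyMeasurable).2 hz

theorem IsRegularPoint.ae_ne {μ : Measure ℂ} {z : ℂ} (h : IsRegularPoint μ z) :
    ∀ᵐ w ∂μ, w ≠ z := by
  rw [ae_iff]; simpa using h.1

theorem IsRegularPoint.integrable {μ : Measure ℂ} [IsProbabilityMeasure μ] {z : ℂ}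
    (h : IsRegularPoint μ z) : Integrable (fun w => Real.log ‖z - w‖) μ :=
  h.2.integrable one_le_two

theorem ennreal_log_enorm {z : ℂ} (hz : z ≠ 0) : ENNReal.log ‖z‖ₑ = (Real.log ‖z‖ : ℝ) := by
  rw [← ofReal_norm, ENNReal.log_ofReal, if_neg (by simpa using hz)]

theorem IsRegularPoint.logPotential_eq {μ : Measure ℂ} [IsProbabilityMeasure μ] {z : ℂ}
    (h : IsRegularPoint μ z) : logPotential μ z = (realPotential μ z : ℝ) := by
  have hi := h.integrable
  rw [logPotential, realPotential, integral_eq_lintegral_pos_part_sub_lintegral_neg_part hi]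
  have h1 : ∫⁻ w, (ENNReal.log ‖z - w‖ₑ).toENNReal ∂μ =
      ∫⁻ w, ENNReal.ofReal (Real.log ‖z - w‖) ∂μ := by
    refine lintegral_congr_ae (h.ae_ne.mono fun w hw => ?_)
    simp only [ennreal_log_enorm (sub_ne_zero.2 hw.symm),
      EReal.toENNReal_of_ne_top (EReal.coe_ne_top _), EReal.toReal_coe]
  have h2 : ∫⁻ w, (-ENNReal.log ‖z - w‖ₑ).toENNReal ∂μ =
      ∫⁻ w, ENNReal.ofReal (-Real.log ‖z - w‖) ∂μ := by
    refine lintegral_congr_ae (h.ae_ne.mono fun w hw => ?_)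
    simp only [ennreal_log_enorm (sub_ne_zero.2 hw.symm), ← EReal.coe_neg,
      EReal.toENNReal_of_ne_top (EReal.coe_ne_top _), EReal.toReal_coe]
  have h3 : ∫⁻ w, ENNReal.ofReal (-Real.log ‖z - w‖) ∂μ ≠ ⊤ := hi.neg.lintegral_lt_top.ne
  rw [h1, h2, EReal.coe_sub, EReal.coe_ennreal_toReal hi.lintegral_lt_top.ne,
    EReal.coe_ennreal_toReal h3]

theorem locallyIntegrable_realPotential {μ : Measure ℂ} [IsProbabilityMeasure μ] {s : ℝ}
    (hμ : ∀ᵐ w ∂μ, ‖w‖ ≤ s) : LocallyIntegrable (realPotential μ) := by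
  intro z
  obtain ⟨k, hk⟩ := exists_nat_gt ‖z‖
  exact ⟨ball 0 k, isOpen_ball.mem_nhds (by simpa using hk),
    (integrable_prod_log_norm_sub hμ k).integral_prod_left⟩

theorem stronglyMeasurable_realPotential (μ : Measure ℂ) [SFinite μ] :
    StronglyMeasurable (realPotential μ) :=
  (by fun_prop : Measurable fun p : ℂ × ℂ => Real.log ‖p.1 - p.2‖).stronglyMeasurable
    |>.integral_prod_right

/-- The maximum of two logarithmic potentials is finite almost everywhere and locally integrable,
and it is almost everywhere the maximum of the real valued potentials. -/
theorem max_logPotential_eq_ae {μ ν : Measure ℂ} [IsProbabilityMeasure μ] [IsProbabilityMeasure ν]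
    {s : ℝ} (hμ : ∀ᵐ w ∂μ, ‖w‖ ≤ s) (hν : ∀ᵐ w ∂ν, ‖w‖ ≤ s) :
    ∀ᵐ z : ℂ, max (logPotential μ z) (logPotential ν z) =
      ((max (realPotential μ z) (realPotential ν z) : ℝ) : EReal) := by
  filter_upwards [ae_isRegularPoint hμ, ae_isRegularPoint hν] with z h1 h2
  rw [h1.logPotential_eq, h2.logPotential_eq]
  exact (EReal.coe_strictMono.monotone.map_max).symm

theorem locallyIntegrable_max_realPotential {μ ν : Measure ℂ} [IsProbabilityMeasure μ]
    [IsProbabilityMeasure ν] {s : ℝ} (hμ : ∀ᵐ w ∂μ, ‖w‖ ≤ s) (hν : ∀ᵐ w ∂ν, ‖w‖ ≤ s) :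
    LocallyIntegrable fun z => max (realPotential μ z) (realPotential ν z) := by
  intro z
  obtain ⟨t, ht, h1⟩ := locallyIntegrable_realPotential hμ z
  obtain ⟨t', ht', h2⟩ := locallyIntegrable_realPotential hν z
  exact ⟨t ∩ t', inter_mem ht ht', (h1.mono_set Set.inter_subset_left).sup
    (h2.mono_set Set.inter_subset_right)⟩

/-! ### The logarithm as fundamental solution of the Laplacian -/

theorem laplacian_eq_fderiv_fderiv {φ : ℂ → ℂ} (hφ : ContDiff ℝ ∞ φ) (z : ℂ) :
    Laplacian.laplacian φ z =
      fderiv ℝ (fun x => fderiv ℝ φ x 1) z 1 +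
        fderiv ℝ (fun x => fderiv ℝ φ x Complex.I) z Complex.I := by
  have hd : DifferentiableAt ℝ (fderiv ℝ φ) z :=
    ((hφ.fderiv_right (m := ∞) (by simp)).differentiable (by simp)) z
  simp only [InnerProductSpace.laplacian_eq_iteratedFDeriv_complexPlane, iteratedFDeriv_two_apply]
  rw [fderiv_clm_apply hd (differentiableAt_const _),
    fderiv_clm_apply hd (differentiableAt_const _)]
  simp

theorem contDiff_fderiv_apply {φ : ℂ → ℂ} (hφ : ContDiff ℝ ∞ φ) (v : ℂ) :
    ContDiff ℝ ∞ fun x => fderiv ℝ φ x v :=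
  (hφ.fderiv_right (m := ∞) (by simp)).clm_apply contDiff_const

theorem continuous_laplacian {φ : ℂ → ℂ} (hφ : ContDiff ℝ ∞ φ) :
    Continuous (Laplacian.laplacian φ) := by
  have h := fun v => (contDiff_fderiv_apply (contDiff_fderiv_apply hφ v) v).continuous
  exact ((h 1).add (h Complex.I)).congr fun z => (laplacian_eq_fderiv_fderiv hφ z).symm

theorem hasCompactSupport_laplacian {φ : ℂ → ℂ} (hφ : ContDiff ℝ ∞ φ) (hc : HasCompactSupport φ) :
    HasCompactSupport (Laplacian.laplacian φ) := by
  have h := fun v => (hc.fderiv_apply ℝ v).fderiv_apply ℝ v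
  have := (h 1).add (h Complex.I)
  rwa [show Laplacian.laplacian φ = _ from funext (laplacian_eq_fderiv_fderiv hφ)]

/-- `∫ g ∂_v ∂_v φ = ∫ (∂_v ∂_v g) φ`. -/
theorem integral_smul_fderiv_fderiv {φ : ℂ → ℂ} (hφ : ContDiff ℝ ∞ φ) (hc : HasCompactSupport φ)
    {g : ℂ → ℝ} (hg : ContDiff ℝ ∞ g) (v : ℂ) :
    ∫ z, g z • fderiv ℝ (fun x => fderiv ℝ φ x v) z v =
      ∫ z, fderiv ℝ (fun x => fderiv ℝ g x v) z v • φ z := by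
  have hg1 : ContDiff ℝ ∞ fun x => fderiv ℝ g x v :=
    (hg.fderiv_right (m := ∞) (by simp)).clm_apply contDiff_const
  have hg2 : ContDiff ℝ ∞ fun z => fderiv ℝ (fun x => fderiv ℝ g x v) z v :=
    (hg1.fderiv_right (m := ∞) (by simp)).clm_apply contDiff_const
  have hφ1 := contDiff_fderiv_apply hφ v
  have hφ2 := contDiff_fderiv_apply hφ1 v
  have hc1 : HasCompactSupport fun x => fderiv ℝ φ x v := hc.fderiv_apply ℝ v
  have hc2 : HasCompactSupport fun z => fderiv ℝ (fun x => fderiv ℝ φ x v) z v :=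
    hc1.fderiv_apply ℝ v
  have key {a : ℂ → ℝ} {b : ℂ → ℂ} (ha : ContDiff ℝ ∞ a) (hb : ContDiff ℝ ∞ b)
      (hcb : HasCompactSupport b) : Integrable fun z => a z • b z :=
    (ha.continuous.smul hb.continuous).integrable_of_hasCompactSupport hcb.smul_left
  rw [integral_smul_fderiv_eq_neg_fderiv_smul_of_integrable (key hg1 hφ1 hc1) (key hg hφ2 hc2)
      (key hg hφ1 hc1) (fun x _ => (hg.differentiable (by simp)) x)
      (fun x _ => (hφ1.differentiable (by simp)) x),
    integral_smul_fderiv_eq_neg_fderiv_smul_of_integrable (key hg2 hφ hc) (key hg1 hφ1 hc1)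
      (key hg1 hφ hc) (fun x _ => (hg1.differentiable (by simp)) x)
      (fun x _ => (hφ.differentiable (by simp)) x), neg_neg]

/-- The smooth regularisation `½ log (|z|² + ε²)` of `log |z|`. -/
noncomputable def smoothLog (ε : ℝ) (z : ℂ) : ℝ := Real.log (‖z‖ ^ 2 + ε ^ 2) / 2

theorem contDiff_smoothLog {ε : ℝ} (hε : 0 < ε) : ContDiff ℝ ∞ (smoothLog ε) :=
  (((contDiff_norm_sq ℝ).add contDiff_const).log fun z => by positivity).div_const 2

theorem fderiv_smoothLog {ε : ℝ} (hε : 0 < ε) (z v : ℂ) :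
    fderiv ℝ (smoothLog ε) z v = inner ℝ z v / (‖z‖ ^ 2 + ε ^ 2) := by
  have h0 : ‖z‖ ^ 2 + ε ^ 2 ≠ 0 := by positivity
  have h1 : HasFDerivAt (fun z : ℂ => ‖z‖ ^ 2 + ε ^ 2) ((2 : ℝ) • innerSL ℝ z) z := by
    simpa [ofNat_smul_eq_nsmul] using ((hasFDerivAt_id z).norm_sq).add_const (ε ^ 2)
  have h2 := (h1.log h0).mul_const (2⁻¹ : ℝ)
  have h3 : HasFDerivAt (smoothLog ε) _ z := h2
  rw [h3.fderiv]
  simp only [_root_.smul_apply, innerSL_apply_apply, smul_eq_mul]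
  field_simp

theorem fderiv_fderiv_smoothLog {ε : ℝ} (hε : 0 < ε) (z v : ℂ) :
    fderiv ℝ (fun x => fderiv ℝ (smoothLog ε) x v) z v =
      ‖v‖ ^ 2 / (‖z‖ ^ 2 + ε ^ 2) - 2 * (inner ℝ z v) ^ 2 / (‖z‖ ^ 2 + ε ^ 2) ^ 2 := by
  have h0 : ‖z‖ ^ 2 + ε ^ 2 ≠ 0 := by positivity
  have h1 : HasFDerivAt (fun z : ℂ => ‖z‖ ^ 2 + ε ^ 2) ((2 : ℝ) • innerSL ℝ z) z := by
    simpa [ofNat_smul_eq_nsmul] using ((hasFDerivAt_id z).norm_sq).add_const (ε ^ 2)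
  have h2 : HasFDerivAt (fun z : ℂ => (inner ℝ z v : ℝ)) (innerSL ℝ v) z := by
    have := (innerSL ℝ v).hasFDerivAt (x := z)
    refine this.congr_of_eventuallyEq (Eventually.of_forall fun x => ?_)
    simp [real_inner_comm]
  simp_rw [fderiv_smoothLog hε]
  have h3 : HasFDerivAt (fun z : ℂ => (inner ℝ z v : ℝ) / (‖z‖ ^ 2 + ε ^ 2)) _ z :=
    h2.mul ((hasDerivAt_inv h0).comp_hasFDerivAt z h1)
  rw [h3.fderiv]
  simp only [_root_.smul_apply, innerSL_apply_apply, smul_eq_mul,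
    _root_.add_apply, real_inner_self_eq_norm_sq]
  field_simp
  ring

theorem laplacian_smoothLog {ε : ℝ} (hε : 0 < ε) (z : ℂ) :
    fderiv ℝ (fun x => fderiv ℝ (smoothLog ε) x 1) z 1 +
        fderiv ℝ (fun x => fderiv ℝ (smoothLog ε) x Complex.I) z Complex.I =
      2 * ε ^ 2 / (‖z‖ ^ 2 + ε ^ 2) ^ 2 := by
  have h0 : ‖z‖ ^ 2 + ε ^ 2 ≠ 0 := by positivity
  rw [fderiv_fderiv_smoothLog hε, fderiv_fderiv_smoothLog hε]
  have h1 : (inner ℝ z 1 : ℝ) ^ 2 + (inner ℝ z Complex.I : ℝ) ^ 2 = ‖z‖ ^ 2 := by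
    rw [Complex.sq_norm, Complex.normSq_apply]
    simp [Complex.inner]; ring
  simp only [norm_one, Complex.norm_I]
  field_simp
  linear_combination (-2) * h1

/-- Green's identity for `smoothLog ε`, after the substitution `z ↦ ε z`. -/
theorem integral_smoothLog_smul_laplacian {φ : ℂ → ℂ} (hφ : ContDiff ℝ ∞ φ)
    (hc : HasCompactSupport φ) {ε : ℝ} (hε : 0 < ε) :
    ∫ z, smoothLog ε z • Laplacian.laplacian φ z =
      ∫ z, (2 / (‖z‖ ^ 2 + 1) ^ 2 : ℝ) • φ (ε • z) := by
  have hg := contDiff_smoothLog hε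
  have hi (v : ℂ) : Integrable fun z => smoothLog ε z • fderiv ℝ (fun x => fderiv ℝ φ x v) z v :=
    (hg.continuous.smul (contDiff_fderiv_apply (contDiff_fderiv_apply hφ v)
      v).continuous).integrable_of_hasCompactSupport
        (HasCompactSupport.smul_left ((hc.fderiv_apply ℝ v).fderiv_apply ℝ v))
  have hg2 (v : ℂ) : ContDiff ℝ ∞ fun z => fderiv ℝ (fun x => fderiv ℝ (smoothLog ε) x v) z v :=
    ((((hg.fderiv_right (m := ∞) (by simp)).clm_apply contDiff_const).fderiv_right
      (m := ∞) (by simp)).clm_apply contDiff_const)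
  have hi2 (v : ℂ) : Integrable fun z =>
      fderiv ℝ (fun x => fderiv ℝ (smoothLog ε) x v) z v • φ z :=
    ((hg2 v).continuous.smul hφ.continuous).integrable_of_hasCompactSupport hc.smul_left
  simp_rw [laplacian_eq_fderiv_fderiv hφ, smul_add]
  rw [integral_add (hi 1) (hi _), integral_smul_fderiv_fderiv hφ hc hg,
    integral_smul_fderiv_fderiv hφ hc hg, ← integral_add (hi2 1) (hi2 _)]
  simp_rw [← add_smul, laplacian_smoothLog hε]
  have h := Measure.integral_comp_smul (volume : Measure ℂ)
    (fun z => (2 * ε ^ 2 / (‖z‖ ^ 2 + ε ^ 2) ^ 2 : ℝ) • φ z) ε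
  rw [Complex.finrank_real_complex, abs_of_pos (by positivity),
    eq_inv_smul_iff₀ (by positivity : ε ^ 2 ≠ 0)] at h
  rw [← h, ← integral_smul]
  refine integral_congr_ae (Eventually.of_forall fun z => ?_)
  simp only [smul_smul, norm_smul, Real.norm_of_nonneg hε.le]
  congr 1
  field_simp

theorem integrable_two_div_norm_sq_add_one :
    Integrable (fun z : ℂ => (2 / (‖z‖ ^ 2 + 1) ^ 2 : ℝ)) ∧
    ∫ z : ℂ, (2 / (‖z‖ ^ 2 + 1) ^ 2 : ℝ) = 2 * Real.pi := by
  have hderiv : ∀ x ∈ Set.Ioi (0 : ℝ), HasDerivAt (fun y : ℝ => -(y ^ 2 + 1)⁻¹)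
      (x ^ (Module.finrank ℝ ℂ - 1) • (2 / (x ^ 2 + 1) ^ 2)) x := by
    intro x _
    have h0 : x ^ 2 + 1 ≠ 0 := by positivity
    have := (((hasDerivAt_pow 2 x).add_const 1).inv h0).neg
    refine HasDerivAt.congr_deriv this ?_
    rw [Complex.finrank_real_complex, smul_eq_mul]
    field_simp
    simp [mul_comm]
  have hcont : ContinuousWithinAt (fun y : ℝ => -(y ^ 2 + 1)⁻¹) (Set.Ici 0) 0 := by
    refine Continuous.continuousWithinAt ?_
    exact (((continuous_pow 2).add continuous_const).inv₀
      (fun x => (by positivity : x ^ 2 + (1 : ℝ) ≠ 0))).neg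
  have hlim : Tendsto (fun y : ℝ => -(y ^ 2 + 1)⁻¹) atTop (𝓝 0) := by
    rw [← neg_zero]
    exact (tendsto_inv_atTop_zero.comp (tendsto_atTop_add_const_right _ _
      (tendsto_pow_atTop two_ne_zero))).neg
  have hpos : ∀ x ∈ Set.Ioi (0 : ℝ),
      0 ≤ (x ^ (Module.finrank ℝ ℂ - 1) • (2 / (x ^ 2 + 1) ^ 2) : ℝ) := by
    intro x hx
    have : 0 < x := hx
    rw [smul_eq_mul]
    positivity
  have h1 := integrableOn_Ioi_deriv_of_nonneg hcont hderiv hpos hlim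
  refine ⟨(integrable_fun_norm_addHaar volume (f := fun y : ℝ => 2 / (y ^ 2 + 1) ^ 2)).2 h1, ?_⟩
  rw [integral_fun_norm_addHaar volume (fun y : ℝ => 2 / (y ^ 2 + 1) ^ 2),
    integral_Ioi_of_hasDerivAt_of_tendsto hcont hderiv h1 hlim]
  simp [Measure.real, Complex.finrank_real_complex]

/-- `(1 / 2π) log |z|` is the fundamental solution of the Laplacian: let `ε` tend to `0` in
`integral_smoothLog_smul_laplacian`. -/
theorem integral_log_norm_smul_laplacian {φ : ℂ → ℂ} (hφ : ContDiff ℝ ∞ φ)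
    (hc : HasCompactSupport φ) :
    ∫ z, Real.log ‖z‖ • Laplacian.laplacian φ z = (2 * Real.pi : ℝ) • φ 0 := by
  set ε : ℕ → ℝ := fun n => 1 / ((n : ℝ) + 1) with hεdef
  have hε (n : ℕ) : 0 < ε n := by positivity
  have hε1 (n : ℕ) : ε n ≤ 1 := by
    simp only [hεdef]
    rw [div_le_one (by positivity)]
    linarith [(Nat.cast_nonneg n : (0 : ℝ) ≤ n)]
  have hεlim : Tendsto ε atTop (𝓝 0) := tendsto_one_div_add_atTop_nhds_zero_nat
  have hcl := continuous_laplacian hφ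
  have hcs := hasCompactSupport_laplacian hφ hc
  obtain ⟨C, hC⟩ := hcl.bounded_above_of_compact_support hcs
  obtain ⟨C', hC'⟩ := hφ.continuous.bounded_above_of_compact_support hc
  obtain ⟨R, hR⟩ := hcs.isCompact.isBounded.subset_ball 0
  have hout (z : ℂ) (hz : z ∉ ball (0 : ℂ) R) : Laplacian.laplacian φ z = 0 :=
    image_eq_zero_of_notMem_tsupport fun h => hz (hR h)
  have hL : Tendsto (fun n => ∫ z, smoothLog (ε n) z • Laplacian.laplacian φ z) atTop
      (𝓝 (∫ z, Real.log ‖z‖ • Laplacian.laplacian φ z)) := by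
    refine tendsto_integral_of_dominated_convergence
      ((ball 0 R).indicator fun z => (|Real.log ‖z‖| + Real.log (‖z‖ ^ 2 + 1) / 2) * C)
      (fun n => ((contDiff_smoothLog (hε n)).continuous.smul hcl).aestronglyMeasurable) ?_
      (fun n => ?_) ?_
    · rw [integrable_indicator_iff measurableSet_ball]
      refine ((integrableOn_ball_log_norm R).abs.add ?_).mul_const C
      have : Continuous fun z : ℂ => Real.log (‖z‖ ^ 2 + 1) / 2 :=
        (Continuous.log (by fun_prop) fun z => by positivity).div_const 2
      exact (this.continuousOn.integrableOn_compact (isCompact_closedBall 0 R)).mono_set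
        ball_subset_closedBall
    · filter_upwards [compl_mem_ae_iff.2 (measure_singleton (0 : ℂ))] with z hz
      by_cases hzR : z ∈ ball (0 : ℂ) R
      · rw [Set.indicator_of_mem hzR, norm_smul]
        have hz0 : 0 < ‖z‖ := norm_pos_iff.2 hz
        refine mul_le_mul ?_ (hC z) (norm_nonneg _) (by
          have := Real.log_nonneg (show 1 ≤ ‖z‖ ^ 2 + 1 by nlinarith)
          positivity)
        have hlow : Real.log ‖z‖ ≤ smoothLog (ε n) z := by
          have : Real.log (‖z‖ ^ 2) ≤ Real.log (‖z‖ ^ 2 + ε n ^ 2) :=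
            Real.log_le_log (by positivity) (by nlinarith [hε n])
          rw [Real.log_pow] at this
          rw [smoothLog]; push_cast at this; linarith
        have hup : smoothLog (ε n) z ≤ Real.log (‖z‖ ^ 2 + 1) / 2 := by
          rw [smoothLog]
          gcongr
          nlinarith [hε n, hε1 n]
        have hnn := Real.log_nonneg (show 1 ≤ ‖z‖ ^ 2 + 1 by nlinarith)
        rw [Real.norm_eq_abs, abs_le]
        constructor
        · linarith [neg_abs_le (Real.log ‖z‖)]
        · linarith [abs_nonneg (Real.log ‖z‖)]
      · rw [Set.indicator_of_notMem hzR, hout z hzR, smul_zero, norm_zero]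
    · filter_upwards [compl_mem_ae_iff.2 (measure_singleton (0 : ℂ))] with z hz
      refine Tendsto.smul_const ?_ _
      have hz0 : 0 < ‖z‖ := norm_pos_iff.2 hz
      have h1 : Tendsto (fun n => ‖z‖ ^ 2 + ε n ^ 2) atTop (𝓝 (‖z‖ ^ 2 + 0 ^ 2)) :=
        tendsto_const_nhds.add (hεlim.pow 2)
      have h2 := (h1.log (by positivity)).div_const 2
      have h3 : Real.log (‖z‖ ^ 2 + 0 ^ 2) / 2 = Real.log ‖z‖ := by
        rw [zero_pow two_ne_zero, add_zero, Real.log_pow]; push_cast; ring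
      rwa [h3] at h2
  have hRt : Tendsto (fun n => ∫ z, (2 / (‖z‖ ^ 2 + 1) ^ 2 : ℝ) • φ (ε n • z)) atTop
      (𝓝 (∫ z : ℂ, (2 / (‖z‖ ^ 2 + 1) ^ 2 : ℝ) • φ 0)) := by
    refine tendsto_integral_of_dominated_convergence
      (fun z : ℂ => (2 / (‖z‖ ^ 2 + 1) ^ 2 : ℝ) * C') (fun n => ?_)
      (integrable_two_div_norm_sq_add_one.1.mul_const C')
      (fun n => Eventually.of_forall fun z => ?_) (Eventually.of_forall fun z => ?_)
    · refine Continuous.aestronglyMeasurable ?_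
      refine Continuous.smul (f := fun z : ℂ => (2 / (‖z‖ ^ 2 + 1) ^ 2 : ℝ)) ?_
        (hφ.continuous.comp (continuous_const_smul (ε n)))
      exact continuous_const.div (by fun_prop) fun z => by positivity
    · rw [norm_smul, Real.norm_of_nonneg (by positivity)]
      exact mul_le_mul_of_nonneg_left (hC' _) (by positivity)
    · refine Tendsto.const_smul ?_ _
      have h1 : Tendsto (fun n => ε n • z) atTop (𝓝 0) := by
        simpa using hεlim.smul_const z
      exact (hφ.continuous.tendsto 0).comp h1
  rw [integral_smul_const, integrable_two_div_norm_sq_add_one.2] at hRt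
  exact tendsto_nhds_unique hL
    (hRt.congr fun n => (integral_smoothLog_smul_laplacian hφ hc (hε n)).symm)

theorem laplacian_comp_add_right {φ : ℂ → ℂ} (hφ : ContDiff ℝ ∞ φ) (w z : ℂ) :
    Laplacian.laplacian (fun z => φ (z + w)) z = Laplacian.laplacian φ (z + w) := by
  have hψ : ContDiff ℝ ∞ fun z => φ (z + w) := hφ.comp (contDiff_id.add contDiff_const)
  rw [laplacian_eq_fderiv_fderiv hψ, laplacian_eq_fderiv_fderiv hφ]
  have h (v : ℂ) : (fun x => fderiv ℝ (fun z => φ (z + w)) x v) =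
      fun x => (fun y => fderiv ℝ φ y v) (x + w) := by
    ext x; rw [fderiv_comp_add_right]
  rw [h, h, fderiv_comp_add_right (f := fun y => fderiv ℝ φ y 1),
    fderiv_comp_add_right (f := fun y => fderiv ℝ φ y Complex.I)]

theorem integral_laplacian_mul_log_norm_sub {φ : ℂ → ℂ} (hφ : ContDiff ℝ ∞ φ)
    (hc : HasCompactSupport φ) (w : ℂ) :
    ∫ z, Laplacian.laplacian φ z * (Real.log ‖z - w‖ : ℂ) = 2 * Real.pi * φ w := by
  have h := integral_log_norm_smul_laplacian (φ := fun z => φ (z + w))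
    (hφ.comp (contDiff_id.add contDiff_const)) (hc.comp_homeomorph (Homeomorph.addRight w))
  simp_rw [laplacian_comp_add_right hφ] at h
  rw [← integral_add_right_eq_self _ w]
  simp only [add_sub_cancel_right]
  rw [zero_add, Complex.real_smul] at h
  push_cast at h
  rw [← h]
  refine integral_congr_ae (Eventually.of_forall fun z => ?_)
  simp only [Complex.real_smul]
  rw [mul_comm]

/-! ### Potentials of root multisets -/

/-- The normalised potential `(1 / n) ∑ log |z - w|` of a multiset of points `w`; it is used for
multisets of cardinality `n`. -/
noncomputable def averageLog (n : ℕ) (s : Multiset ℂ) (z : ℂ) : ℝ :=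
  (1 / (n : ℝ)) * (s.map fun w => Real.log ‖z - w‖).sum

theorem measurable_averageLog (n : ℕ) (s : Multiset ℂ) : Measurable (averageLog n s) := by
  refine Measurable.const_mul ?_ _
  induction s using Multiset.induction with
  | empty => simp
  | cons a s ih =>
    simp only [Multiset.map_cons, Multiset.sum_cons]
    exact (by fun_prop : Measurable fun z : ℂ => Real.log ‖z - a‖).add ih

theorem integrable_mul_log_norm_sub {h : ℂ → ℂ} (hh : Continuous h) (hc : HasCompactSupport h)
    (w : ℂ) : Integrable fun z => h z * (Real.log ‖z - w‖ : ℂ) := by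
  have hloc : LocallyIntegrable (realPotential (Measure.dirac w)) :=
    locallyIntegrable_realPotential (s := ‖w‖)
      ((ae_dirac_iff (measurableSet_le measurable_norm measurable_const)).2 le_rfl)
  have h1 := (hloc.integrable_smul_right_of_hasCompactSupport hh hc)
  refine h1.congr (Eventually.of_forall fun z => ?_)
  simp [realPotential, Complex.real_smul, mul_comm]

theorem integral_laplacian_mul_multiset_sum_log {φ : ℂ → ℂ} (hφ : ContDiff ℝ ∞ φ)
    (hc : HasCompactSupport φ) (s : Multiset ℂ) :
    Integrable (fun z => Laplacian.laplacian φ z *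
        (((s.map fun w => Real.log ‖z - w‖).sum : ℝ) : ℂ)) ∧
      ∫ z, Laplacian.laplacian φ z * (((s.map fun w => Real.log ‖z - w‖).sum : ℝ) : ℂ) =
        2 * Real.pi * (s.map φ).sum := by
  induction s using Multiset.induction with
  | empty => simp
  | cons a s ih =>
    have h1 := integrable_mul_log_norm_sub (continuous_laplacian hφ)
      (hasCompactSupport_laplacian hφ hc) a
    simp only [Multiset.map_cons, Multiset.sum_cons, Complex.ofReal_add, mul_add]
    refine ⟨h1.add ih.1, ?_⟩
    rw [integral_add h1 ih.1, ih.2, integral_laplacian_mul_log_norm_sub hφ hc]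

theorem zeroAverage_eq_integral {φ : ℂ → ℂ} (hφ : ContDiff ℝ ∞ φ) (hc : HasCompactSupport φ)
    (n : ℕ) (f : Polynomial ℂ) :
    zeroAverage φ n f = (1 / (2 * (Real.pi : ℂ))) *
      ∫ z, Laplacian.laplacian φ z * (averageLog n f.roots z : ℂ) := by
  have h := (integral_laplacian_mul_multiset_sum_log hφ hc f.roots).2
  have h2 : ∫ z, Laplacian.laplacian φ z * (averageLog n f.roots z : ℂ) =
      (1 / (n : ℂ)) * ∫ z, Laplacian.laplacian φ z *
        (((f.roots.map fun w => Real.log ‖z - w‖).sum : ℝ) : ℂ) := by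
    rw [← integral_const_mul]
    refine integral_congr_ae (Eventually.of_forall fun z => ?_)
    simp only [averageLog]
    push_cast
    ring
  have hpi : (Real.pi : ℂ) ≠ 0 := Complex.ofReal_ne_zero.2 Real.pi_ne_zero
  rw [h2, h, zeroAverage]
  field_simp

theorem averageLog_roots {f : Polynomial ℂ} {z : ℂ} (n : ℕ) (hz : f.eval z ≠ 0) :
    averageLog n f.roots z = (1 / (n : ℝ)) * (Real.log ‖f.eval z‖ - Real.log ‖f.leadingCoeff‖) := by
  have key (s : Multiset ℂ) (hs : (s.map fun w => z - w).prod ≠ 0) :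
      Real.log ‖(s.map fun w => z - w).prod‖ = (s.map fun w => Real.log ‖z - w‖).sum := by
    induction s using Multiset.induction with
    | empty => simp
    | cons a s ih =>
      simp only [Multiset.map_cons, Multiset.prod_cons, Multiset.sum_cons] at hs ⊢
      rw [norm_mul, Real.log_mul (norm_ne_zero_iff.2 (left_ne_zero_of_mul hs))
        (norm_ne_zero_iff.2 (right_ne_zero_of_mul hs)), ih (right_ne_zero_of_mul hs)]
  have he := (IsAlgClosed.splits f).eval_eq_prod_roots z
  rw [he] at hz
  rw [averageLog, he, norm_mul, Real.log_mul (norm_ne_zero_iff.2 (left_ne_zero_of_mul hz))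
    (norm_ne_zero_iff.2 (right_ne_zero_of_mul hz)), key _ (right_ne_zero_of_mul hz)]
  ring

theorem ae_eval_ne_zero {f : Polynomial ℂ} (hf : f ≠ 0) : ∀ᵐ z : ℂ, f.eval z ≠ 0 := by
  have : (f.roots.toFinset : Set ℂ)ᶜ ∈ ae (volume : Measure ℂ) :=
    compl_mem_ae_iff.2 (Finset.measure_zero _ _)
  filter_upwards [this] with z hz h0
  exact hz (by simpa [hf] using h0)

/-! ### Convergence of integrals against averaged logarithms -/

/-- The negative part of `log |z|`, as an extended nonnegative real. -/
noncomputable def negLog (z : ℂ) : ℝ≥0∞ := ENNReal.ofReal (-Real.log ‖z‖)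

theorem lintegral_negLog_ne_top : ∫⁻ z, negLog z ≠ ⊤ := by
  have h : ∫⁻ z, negLog z = ∫⁻ z in ball (0 : ℂ) 1, negLog z := by
    rw [← lintegral_indicator measurableSet_ball]
    refine lintegral_congr fun z => ?_
    by_cases hz : z ∈ ball (0 : ℂ) 1
    · rw [Set.indicator_of_mem hz]
    · rw [Set.indicator_of_notMem hz, negLog, ENNReal.ofReal_eq_zero]
      simp only [mem_ball_zero_iff, not_lt] at hz
      linarith [Real.log_nonneg hz]
  rw [h]
  exact (integrableOn_ball_log_norm 1).neg.lintegral_lt_top.ne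

/-- Absolute continuity of the integral of `negLog`, uniformly in the translation `w`. -/
theorem exists_setLIntegral_negLog_sub_lt {ε : ℝ≥0∞} (hε : ε ≠ 0) :
    ∃ δ > 0, ∀ s : Set ℂ, volume s < δ → ∀ w : ℂ, ∫⁻ z in s, negLog (z - w) < ε := by
  obtain ⟨δ, hδ, h⟩ := exists_pos_setLIntegral_lt_of_measure_lt lintegral_negLog_ne_top hε
  refine ⟨δ, hδ, fun s hs w => ?_⟩
  have hmp := measurePreserving_sub_right (volume : Measure ℂ) w
  have hemb : MeasurableEmbedding (fun z : ℂ => z - w) :=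
    (MeasurableEquiv.subRight w).measurableEmbedding
  have hset : s = (fun z => z - w) ⁻¹' ((fun z => z + w) ⁻¹' s) := by
    ext z; simp
  rw [hset, hmp.setLIntegral_comp_preimage_emb hemb]
  exact h _ (by rwa [measure_preimage_add_right])

/-- Where a normalised potential is at most `C`, its absolute value is controlled by the negative
parts of its terms alone. -/
theorem enorm_averageLog_le {n : ℕ} {s : Multiset ℂ} {z : ℂ} {C : ℝ}
    (h : averageLog n s z ≤ C) :
    ‖averageLog n s z‖ₑ ≤
      ENNReal.ofReal C + (n : ℝ≥0∞)⁻¹ * (s.map fun w => negLog (z - w)).sum := by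
  have hsum (s : Multiset ℂ) : ENNReal.ofReal (-(s.map fun w => Real.log ‖z - w‖).sum) ≤
      (s.map fun w => negLog (z - w)).sum := by
    induction s using Multiset.induction with
    | empty => simp
    | cons a s ih =>
      simp only [Multiset.map_cons, Multiset.sum_cons, neg_add]
      exact ENNReal.ofReal_add_le.trans (add_le_add le_rfl ih)
  rw [Real.enorm_eq_ofReal_abs]
  rcases le_total 0 (averageLog n s z) with h0 | h0
  · rw [abs_of_nonneg h0]
    exact (ENNReal.ofReal_le_ofReal h).trans le_self_add
  · rw [abs_of_nonpos h0]
    refine le_trans ?_ le_add_self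
    rcases Nat.eq_zero_or_pos n with rfl | hn
    · simp [averageLog]
    · have hn' : (0 : ℝ) < n := Nat.cast_pos.2 hn
      rw [averageLog, ← mul_neg, ENNReal.ofReal_mul (by positivity), one_div,
        ENNReal.ofReal_inv_of_pos hn', ENNReal.ofReal_natCast]
      exact mul_le_mul_right (hsum s) _

theorem setLIntegral_multiset_sum_negLog_le {t : Set ℂ} {ε : ℝ≥0∞}
    (ht : ∀ w : ℂ, ∫⁻ z in t, negLog (z - w) ≤ ε) (s : Multiset ℂ) :
    ∫⁻ z in t, (s.map fun w => negLog (z - w)).sum ≤ s.card * ε := by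
  induction s using Multiset.induction with
  | empty => simp
  | cons a s ih =>
    simp only [Multiset.map_cons, Multiset.sum_cons, Multiset.card_cons, Nat.cast_add, Nat.cast_one]
    rw [lintegral_add_left (by unfold negLog; fun_prop), add_mul, one_mul, add_comm]
    exact add_le_add ih (ht a)

/-- Normalised potentials that are bounded above on a ball are uniformly integrable on it: the
negative parts are averages of translates of one integrable function. -/
theorem unifIntegrable_averageLog {n : ℕ → ℕ} {s : ℕ → Multiset ℂ} (hs : ∀ k, (s k).card ≤ n k)
    {R C : ℝ} (hC : ∀ k, ∀ᵐ z ∂((volume : Measure ℂ).restrict (ball 0 R)),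
      averageLog (n k) (s k) z ≤ C) :
    UnifIntegrable (fun k => averageLog (n k) (s k)) 1
      ((volume : Measure ℂ).restrict (ball 0 R)) := by
  intro ε hε
  obtain ⟨δ, hδ, hδε⟩ := exists_setLIntegral_negLog_sub_lt
    (ε := ENNReal.ofReal (ε / 2)) (by simpa using hε)
  obtain ⟨δ', hδ'0, hδ'⟩ := ENNReal.lt_iff_exists_real_btwn.1 hδ
  have hδ'pos : 0 < δ' := ENNReal.ofReal_pos.1 hδ'.1
  refine ⟨min δ' (ε / 2 / (|C| + 1)), by positivity, fun k t ht hμt => ?_⟩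
  rw [eLpNorm_indicator_eq_eLpNorm_restrict ht, eLpNorm_one_eq_lintegral_enorm,
    Measure.restrict_restrict ht]
  rw [Measure.restrict_apply ht] at hμt
  have h1 : ∫⁻ z in t ∩ ball 0 R, ‖averageLog (n k) (s k) z‖ₑ ≤
      ∫⁻ z in t ∩ ball 0 R, (ENNReal.ofReal C +
        (n k : ℝ≥0∞)⁻¹ * ((s k).map fun w => negLog (z - w)).sum) := by
    refine lintegral_mono_ae ?_
    have := ae_mono (Measure.restrict_mono (μ := (volume : Measure ℂ))
      (Set.inter_subset_right (s := t) (t := ball 0 R)) le_rfl) (hC k)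
    filter_upwards [this] with z hz
    exact enorm_averageLog_le hz
  refine h1.trans ?_
  rw [lintegral_add_left measurable_const, setLIntegral_const]
  have h2 : ENNReal.ofReal C * volume (t ∩ ball 0 R) ≤ ENNReal.ofReal (ε / 2) := by
    calc ENNReal.ofReal C * volume (t ∩ ball 0 R)
        ≤ ENNReal.ofReal (|C| + 1) * ENNReal.ofReal (ε / 2 / (|C| + 1)) := by
          refine mul_le_mul' (ENNReal.ofReal_le_ofReal (by linarith [le_abs_self C])) (hμt.trans ?_)
          exact ENNReal.ofReal_le_ofReal (min_le_right _ _)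
      _ = ENNReal.ofReal (ε / 2) := by
          rw [← ENNReal.ofReal_mul (by positivity)]
          congr 1
          field_simp
  have h3 : ∫⁻ z in t ∩ ball 0 R, (n k : ℝ≥0∞)⁻¹ * ((s k).map fun w => negLog (z - w)).sum ≤
      ENNReal.ofReal (ε / 2) := by
    rcases Nat.eq_zero_or_pos (n k) with h0 | hn
    · have : s k = 0 := Multiset.card_eq_zero.1 (Nat.le_zero.1 (h0 ▸ hs k))
      simp [this]
    · rw [lintegral_const_mul' _ _ (by simp [hn.ne'])]
      have hlt : volume (t ∩ ball 0 R) < δ :=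
        (hμt.trans (ENNReal.ofReal_le_ofReal (min_le_left _ _))).trans_lt hδ'.2
      calc (n k : ℝ≥0∞)⁻¹ * ∫⁻ z in t ∩ ball 0 R, ((s k).map fun w => negLog (z - w)).sum
          ≤ (n k : ℝ≥0∞)⁻¹ * ((n k : ℝ≥0∞) * ENNReal.ofReal (ε / 2)) := by
            refine mul_le_mul_right ?_ _
            refine (setLIntegral_multiset_sum_negLog_le (fun w => (hδε _ hlt w).le) (s k)).trans ?_
            exact mul_le_mul_left (by exact_mod_cast hs k) _
        _ = ENNReal.ofReal (ε / 2) := by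
            rw [← mul_assoc, ENNReal.inv_mul_cancel (by simp [hn.ne']) (by simp), one_mul]
  calc _ ≤ ENNReal.ofReal (ε / 2) + ENNReal.ofReal (ε / 2) := add_le_add h2 h3
    _ = ENNReal.ofReal ε := by
      rw [← ENNReal.ofReal_add (by positivity) (by positivity), add_halves]

/-- Almost everywhere convergence of normalised potentials that are locally bounded above implies
their convergence as distributions. -/
theorem tendsto_integral_mul_averageLog {n : ℕ → ℕ} {s : ℕ → Multiset ℂ}
    (hs : ∀ k, (s k).card ≤ n k)
    (hC : ∀ R : ℝ, ∃ C : ℝ, ∀ k, ∀ᵐ z ∂((volume : Measure ℂ).restrict (ball 0 R)),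
      averageLog (n k) (s k) z ≤ C)
    {V : ℂ → ℝ} (hV : LocallyIntegrable V)
    (hlim : ∀ᵐ z : ℂ, Tendsto (fun k => averageLog (n k) (s k) z) atTop (𝓝 (V z)))
    {h : ℂ → ℂ} (hh : Continuous h) (hc : HasCompactSupport h) :
    Tendsto (fun k => ∫ z, h z * (averageLog (n k) (s k) z : ℂ)) atTop
      (𝓝 (∫ z, h z * (V z : ℂ))) := by
  obtain ⟨R, hR⟩ := hc.isCompact.isBounded.subset_ball 0
  obtain ⟨C, hC⟩ := hC R
  obtain ⟨B, hB⟩ := hh.bounded_above_of_compact_support hc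
  set m := (volume : Measure ℂ).restrict (ball 0 R) with hm
  have : IsFiniteMeasure m := isFiniteMeasure_restrict.2 measure_ball_lt_top.ne
  have hVm : Integrable V m :=
    (hV.integrableOn_isCompact (isCompact_closedBall 0 R)).mono_set ball_subset_closedBall
  have hui := unifIntegrable_averageLog hs hC
  have hL := tendsto_Lp_finite_of_tendsto_ae (p := 1) le_rfl ENNReal.one_ne_top
    (fun k => (measurable_averageLog (n k) (s k)).aestronglyMeasurable)
    (memLp_one_iff_integrable.2 hVm) hui (ae_restrict_of_ae hlim)
  have hball (g : ℂ → ℝ) : ∫ z, h z * (g z : ℂ) = ∫ z, h z * (g z : ℂ) ∂m := by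
    refine (setIntegral_eq_integral_of_forall_compl_eq_zero fun z hz => ?_).symm
    rw [image_eq_zero_of_notMem_tsupport fun hz' => hz (hR hz'), zero_mul]
  simp_rw [hball]
  refine tendsto_integral_of_L1' _ ?_ (Eventually.of_forall fun k => ?_) ?_
  · exact hh.aestronglyMeasurable.mul
      (Complex.continuous_ofReal.comp_aestronglyMeasurable hVm.aestronglyMeasurable)
  · have hi : Integrable (fun z =>
        h z * ((((s k).map fun w => Real.log ‖z - w‖).sum : ℝ) : ℂ)) := by
      generalize s k = s'
      induction s' using Multiset.induction with
      | empty => simp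
      | cons a s' ih =>
        simp only [Multiset.map_cons, Multiset.sum_cons, Complex.ofReal_add, mul_add]
        exact (integrable_mul_log_norm_sub hh hc a).add ih
    refine ((hi.const_mul (1 / (n k : ℂ))).restrict).congr (Eventually.of_forall fun z => ?_)
    simp only [averageLog]
    push_cast
    ring
  · refine tendsto_of_tendsto_of_tendsto_of_le_of_le tendsto_const_nhds
      (by simpa using ENNReal.Tendsto.const_mul hL (Or.inr ENNReal.ofReal_ne_top))
      (fun _ => zero_le) (fun k => ?_) (g := fun _ => 0)
      (h := fun k => ENNReal.ofReal B * eLpNorm (averageLog (n k) (s k) - V) 1 m)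
    refine eLpNorm_le_mul_eLpNorm_of_ae_le_mul (Eventually.of_forall fun z => ?_) 1
    simp only [Pi.sub_apply]
    rw [← mul_sub, norm_mul, ← Complex.ofReal_sub, Complex.norm_real]
    exact mul_le_mul_of_nonneg_right (hB z) (norm_nonneg _)

/-! ### Measures are determined by smooth test functions -/

theorem measure_eq_of_isBounded_of_integral_eq {m₁ m₂ : Measure ℂ} [IsLocallyFiniteMeasure m₁]
    [IsLocallyFiniteMeasure m₂]
    (h : ∀ φ : ℂ → ℂ, ContDiff ℝ ∞ φ → HasCompactSupport φ → ∫ z, φ z ∂m₁ = ∫ z, φ z ∂m₂)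
    {V : Set ℂ} (hV : IsOpen V) (hb : Bornology.IsBounded V) : m₁ V = m₂ V := by
  obtain ⟨f, hfs, hfc, hf01⟩ := hV.exists_contDiff_support_eq (n := ⊤)
  -- The functions `ψ k` increase to the indicator of `V`, since `f > 0` exactly on `V`.
  let ψ : ℕ → ℂ → ℂ := fun k z => ((Real.smoothTransition (k * f z) : ℝ) : ℂ)
  have hf0 (z : ℂ) : 0 ≤ f z := (hf01 ⟨z, rfl⟩).1
  have hzero (k : ℕ) {z : ℂ} (hz : z ∉ V) : ψ k z = 0 := by
    have : f z = 0 := by rwa [← hfs, Function.mem_support, not_not] at hz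
    simp [ψ, this, Real.smoothTransition.zero_of_nonpos]
  have hψ (k : ℕ) : ContDiff ℝ ∞ (ψ k) :=
    Complex.ofRealCLM.contDiff.comp
      (Real.smoothTransition.contDiff.comp (contDiff_const.mul hfc))
  have hcs (k : ℕ) : HasCompactSupport (ψ k) :=
    HasCompactSupport.intro hb.isCompact_closure fun z hz => hzero k fun h => hz (subset_closure h)
  have hlt (m : Measure ℂ) [IsLocallyFiniteMeasure m] : m V < ⊤ :=
    (measure_mono subset_closure).trans_lt hb.isCompact_closure.measure_lt_top
  have key (m : Measure ℂ) [IsLocallyFiniteMeasure m] :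
      Tendsto (fun k => ∫ z, ψ k z ∂m) atTop (𝓝 ((m.real V : ℝ) : ℂ)) := by
    have h1 : ((m.real V : ℝ) : ℂ) = ∫ z, V.indicator (fun _ => (1 : ℂ)) z ∂m := by
      rw [integral_indicator hV.measurableSet]
      simp
    rw [h1]
    refine tendsto_integral_of_dominated_convergence (V.indicator fun _ => (1 : ℝ))
      (fun k => (hψ k).continuous.aestronglyMeasurable) ?_
      (fun k => Eventually.of_forall fun z => ?_) (Eventually.of_forall fun z => ?_)
    · exact (integrable_indicator_iff hV.measurableSet).2 (integrableOn_const (hlt m).ne)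
    · by_cases hz : z ∈ V
      · rw [Set.indicator_of_mem hz, Complex.norm_real,
          Real.norm_of_nonneg (Real.smoothTransition.nonneg _)]
        exact Real.smoothTransition.le_one _
      · simp [hzero k hz, hz]
    · by_cases hz : z ∈ V
      · rw [Set.indicator_of_mem hz]
        have hpos : 0 < f z := (hf0 z).lt_of_ne' (by rwa [← Function.mem_support, hfs])
        refine tendsto_const_nhds.congr' ?_
        obtain ⟨N, hN⟩ := exists_nat_gt (1 / f z)
        filter_upwards [eventually_ge_atTop N] with k hk
        have : 1 ≤ k * f z := by
          have h2 : (N : ℝ) ≤ k := Nat.cast_le.2 hk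
          rw [div_lt_iff₀ hpos] at hN
          nlinarith
        simp [ψ, Real.smoothTransition.one_of_one_le this]
      · simp [hzero _ hz, hz]
  have h2 := tendsto_nhds_unique (key m₁)
    ((key m₂).congr fun k => (h (ψ k) (hψ k) (hcs k)).symm)
  have h3 : m₁.real V = m₂.real V := by exact_mod_cast h2
  exact (measureReal_eq_measureReal_iff (hlt m₁).ne (hlt m₂).ne).1 h3

theorem measure_ext_of_integral_contDiff {m₁ m₂ : Measure ℂ} [IsLocallyFiniteMeasure m₁]
    [IsLocallyFiniteMeasure m₂]
    (h : ∀ φ : ℂ → ℂ, ContDiff ℝ ∞ φ → HasCompactSupport φ → ∫ z, φ z ∂m₁ = ∫ z, φ z ∂m₂) :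
    m₁ = m₂ := by
  have hball : ⋃ k : ℕ, ball (0 : ℂ) k = Set.univ := iUnion_ball_nat 0
  have hmono : Monotone fun k : ℕ => ball (0 : ℂ) k :=
    fun a b hab => ball_subset_ball (Nat.cast_le.2 hab)
  refine Measure.ext_of_generateFrom_of_iUnion {s | IsOpen s} (fun k : ℕ => ball (0 : ℂ) k)
    BorelSpace.measurable_eq isPiSystem_isOpen hball
    (fun _ => by simp) (fun k => measure_ball_lt_top.ne) fun V hV' => ?_
  have hV : IsOpen V := by simpa using hV'
  have hVk : V = ⋃ k : ℕ, V ∩ ball (0 : ℂ) k := by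
    rw [← Set.inter_iUnion, hball, Set.inter_univ]
  have hmono' : Monotone fun k : ℕ => V ∩ ball (0 : ℂ) k :=
    fun a b hab => Set.inter_subset_inter_right V (hmono hab)
  rw [hVk, hmono'.measure_iUnion, hmono'.measure_iUnion]
  refine iSup_congr fun k => ?_
  exact measure_eq_of_isBounded_of_integral_eq h (hV.inter isOpen_ball)
    (isBounded_ball.subset Set.inter_subset_right)

/-! ### Compactness of empirical measures -/

/-- The normalised counting measure `(1 / n) ∑ δ_w` of a multiset of points `w`; it is used for
multisets of cardinality `n`. -/
noncomputable def empiricalMeasure (n : ℕ) (s : Multiset ℂ) : Measure ℂ :=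
  (n : ℝ≥0∞)⁻¹ • (s.map Measure.dirac).sum

theorem lintegral_multiset_sum_dirac (s : Multiset ℂ) {g : ℂ → ℝ≥0∞} (hg : Measurable g) :
    ∫⁻ z, g z ∂(s.map Measure.dirac).sum = (s.map g).sum := by
  induction s using Multiset.induction with
  | empty => simp
  | cons a s ih =>
    simp only [Multiset.map_cons, Multiset.sum_cons]
    rw [lintegral_add_measure, ih, lintegral_dirac' a hg]

theorem isProbabilityMeasure_empiricalMeasure {n : ℕ} {s : Multiset ℂ} (hn : 0 < n)
    (hs : s.card = n) : IsProbabilityMeasure (empiricalMeasure n s) := by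
  refine ⟨?_⟩
  rw [empiricalMeasure, Measure.smul_apply, ← lintegral_one,
    lintegral_multiset_sum_dirac s measurable_const]
  simp only [Multiset.map_const', Multiset.sum_replicate, hs, nsmul_eq_mul, mul_one, smul_eq_mul]
  exact ENNReal.inv_mul_cancel (by simp [hn.ne']) (by simp)

theorem integral_empiricalMeasure {n : ℕ} (s : Multiset ℂ) (φ : ℂ → ℂ) :
    ∫ z, φ z ∂empiricalMeasure n s = (1 / (n : ℂ)) * (s.map φ).sum := by
  have h : Integrable φ (s.map Measure.dirac).sum ∧
      ∫ z, φ z ∂(s.map Measure.dirac).sum = (s.map φ).sum := by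
    induction s using Multiset.induction with
    | empty => simp
    | cons a s ih =>
      simp only [Multiset.map_cons, Multiset.sum_cons]
      have ha : Integrable φ (Measure.dirac a) := integrable_dirac (by simp)
      exact ⟨ha.add_measure ih.1, by rw [integral_add_measure ha ih.1, ih.2, integral_dirac]⟩
  rw [empiricalMeasure, integral_smul_measure, h.2]
  simp [Complex.real_smul]

/-- Markov's inequality for `log⁺ |z|`. -/
theorem empiricalMeasure_norm_gt_le {n : ℕ} {s : Multiset ℂ} (hn : 0 < n) {C r : ℝ}
    (hr : 1 < r) (hC : (s.map fun w => Real.posLog ‖w‖).sum ≤ n * C) :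
    empiricalMeasure n s {z | r < ‖z‖} ≤ ENNReal.ofReal C / ENNReal.ofReal (Real.log r) := by
  have hlog : 0 < Real.log r := Real.log_pos hr
  have hm : Measurable fun z : ℂ => ENNReal.ofReal (Real.posLog ‖z‖) := by
    unfold Real.posLog; fun_prop
  have h1 : ∫⁻ z, ENNReal.ofReal (Real.posLog ‖z‖) ∂empiricalMeasure n s ≤ ENNReal.ofReal C := by
    rw [empiricalMeasure, lintegral_smul_measure, lintegral_multiset_sum_dirac s hm]
    have h2 : (s.map fun w => ENNReal.ofReal (Real.posLog ‖w‖)).sum =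
        ENNReal.ofReal (s.map fun w => Real.posLog ‖w‖).sum := by
      clear hC
      induction s using Multiset.induction with
      | empty => simp
      | cons a s ih =>
        simp only [Multiset.map_cons, Multiset.sum_cons]
        rw [ih, ENNReal.ofReal_add Real.posLog_nonneg]
        refine Multiset.sum_nonneg fun x hx => ?_
        obtain ⟨w, -, rfl⟩ := Multiset.mem_map.1 hx
        exact Real.posLog_nonneg
    rw [h2]
    calc (n : ℝ≥0∞)⁻¹ • ENNReal.ofReal (s.map fun w => Real.posLog ‖w‖).sum
        ≤ (n : ℝ≥0∞)⁻¹ * ENNReal.ofReal (n * C) :=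
          mul_le_mul_right (ENNReal.ofReal_le_ofReal hC) _
      _ = ENNReal.ofReal C := by
          rw [ENNReal.ofReal_mul (by positivity), ENNReal.ofReal_natCast, ← mul_assoc,
            ENNReal.inv_mul_cancel (by simp [hn.ne']) (by simp), one_mul]
  refine le_trans (measure_mono fun z hz => ?_)
    ((meas_ge_le_lintegral_div hm.aemeasurable (by simpa using hlog) ENNReal.ofReal_ne_top).trans
      (ENNReal.div_le_div_right h1 _))
  have hz' : r < ‖z‖ := hz
  refine ENNReal.ofReal_le_ofReal ?_
  rw [Real.posLog]
  exact (Real.log_le_log (by linarith) hz'.le).trans (le_max_right _ _)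

/-- Point configurations with bounded average of `log⁺ |w|` have subsequential limits that are
probability measures: no mass escapes to infinity. -/
theorem exists_subseq_tendsto_empiricalMeasure {n : ℕ → ℕ} {s : ℕ → Multiset ℂ}
    (hn : ∀ k, 0 < n k) (hs : ∀ k, (s k).card = n k) {C : ℝ}
    (hC : ∀ k, ((s k).map fun w => Real.posLog ‖w‖).sum ≤ n k * C) :
    ∃ ρ : Measure ℂ, IsProbabilityMeasure ρ ∧ ∃ ns : ℕ → ℕ, StrictMono ns ∧
      ∀ φ : ℂ → ℂ, Continuous φ → HasCompactSupport φ →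
        Tendsto (fun k => (1 / (n (ns k) : ℂ)) * ((s (ns k)).map φ).sum) atTop
          (𝓝 (∫ z, φ z ∂ρ)) := by
  let M : ℕ → ProbabilityMeasure ℂ := fun k =>
    ⟨empiricalMeasure (n k) (s k), isProbabilityMeasure_empiricalMeasure (hn k) (hs k)⟩
  have htight : IsTightMeasureSet {((m : ProbabilityMeasure ℂ) : Measure ℂ) | m ∈ Set.range M} := by
    refine isTightMeasureSet_of_tendsto_measure_norm_gt ?_
    have hlim : Tendsto (fun r : ℝ => ENNReal.ofReal C / ENNReal.ofReal (Real.log r)) atTop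
        (𝓝 0) := by
      have h1 : Tendsto (fun r : ℝ => ENNReal.ofReal (Real.log r)) atTop (𝓝 ⊤) :=
        ENNReal.tendsto_ofReal_atTop.comp Real.tendsto_log_atTop
      simpa using ENNReal.Tendsto.const_div h1 (Or.inr ENNReal.ofReal_ne_top)
    refine tendsto_of_tendsto_of_tendsto_of_le_of_le' tendsto_const_nhds hlim
      (Eventually.of_forall fun _ => zero_le) ?_
    filter_upwards [eventually_gt_atTop 1] with r hr
    refine iSup₂_le ?_
    rintro _ ⟨_, ⟨k, rfl⟩, rfl⟩
    exact empiricalMeasure_norm_gt_le (hn k) hr (hC k)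
  obtain ⟨ρ, -, ns, hns, hlim⟩ := (isCompact_closure_of_isTightMeasureSet htight).tendsto_subseq
    (fun k => subset_closure (Set.mem_range_self k))
  refine ⟨ρ, inferInstance, ns, hns, fun φ hφ hc => ?_⟩
  obtain ⟨B, hB⟩ := hφ.bounded_above_of_compact_support hc
  have := (ProbabilityMeasure.tendsto_iff_forall_integral_rclike_tendsto ℂ).1 hlim
    (BoundedContinuousFunction.ofNormedAddCommGroup φ hφ B hB)
  refine this.congr fun k => ?_
  exact integral_empiricalMeasure (s (ns k)) φ

/-! ### Sums of monic polynomials -/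

theorem monic_polyOfRoots (x : ℕ → ℂ) (n : ℕ) : (polyOfRoots x n).Monic :=
  Polynomial.monic_prod_of_monic _ _ fun i _ => Polynomial.monic_X_sub_C (x i)

theorem natDegree_polyOfRoots (x : ℕ → ℂ) (n : ℕ) : (polyOfRoots x n).natDegree = n := by
  rw [polyOfRoots, Polynomial.natDegree_prod_of_monic _ _ fun i _ => Polynomial.monic_X_sub_C (x i)]
  simp

theorem eval_polyOfRoots (x : ℕ → ℂ) (n : ℕ) (z : ℂ) :
    (polyOfRoots x n).eval z = ∏ i ∈ Finset.range n, (z - x i) := by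
  simp [polyOfRoots, Polynomial.eval_prod]

theorem coeff_polyOfRoots_add (x y : ℕ → ℂ) (n : ℕ) :
    (polyOfRoots x n + polyOfRoots y n).coeff n = 2 := by
  have h (x : ℕ → ℂ) : (polyOfRoots x n).coeff n = 1 := by
    have := (monic_polyOfRoots x n).coeff_natDegree
    rwa [natDegree_polyOfRoots] at this
  rw [Polynomial.coeff_add, h, h]
  norm_num

theorem natDegree_polyOfRoots_add (x y : ℕ → ℂ) (n : ℕ) :
    (polyOfRoots x n + polyOfRoots y n).natDegree = n := by
  refine le_antisymm ?_ (Polynomial.le_natDegree_of_ne_zero 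
    (by rw [coeff_polyOfRoots_add]; exact two_ne_zero))
  refine (Polynomial.natDegree_add_le _ _).trans ?_
  simp [natDegree_polyOfRoots]

theorem leadingCoeff_polyOfRoots_add (x y : ℕ → ℂ) (n : ℕ) :
    (polyOfRoots x n + polyOfRoots y n).leadingCoeff = 2 := by
  rw [Polynomial.leadingCoeff, natDegree_polyOfRoots_add, coeff_polyOfRoots_add]

theorem polyOfRoots_add_ne_zero (x y : ℕ → ℂ) (n : ℕ) :
    polyOfRoots x n + polyOfRoots y n ≠ 0 := by
  rw [← Polynomial.leadingCoeff_ne_zero, leadingCoeff_polyOfRoots_add]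
  exact two_ne_zero

theorem card_roots_polyOfRoots_add (x y : ℕ → ℂ) (n : ℕ) :
    (polyOfRoots x n + polyOfRoots y n).roots.card = n := by
  rw [← (IsAlgClosed.splits _).natDegree_eq_card_roots, natDegree_polyOfRoots_add]

theorem norm_eval_polyOfRoots_add_le {x y : ℕ → ℂ} {s R : ℝ} (hx : ∀ i, ‖x i‖ ≤ s)
    (hy : ∀ i, ‖y i‖ ≤ s) (n : ℕ) {z : ℂ} (hz : ‖z‖ ≤ R) :
    ‖(polyOfRoots x n + polyOfRoots y n).eval z‖ ≤ 2 * (R + s) ^ n := by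
  have h {x : ℕ → ℂ} (hx : ∀ i, ‖x i‖ ≤ s) : ‖(polyOfRoots x n).eval z‖ ≤ (R + s) ^ n := by
    rw [eval_polyOfRoots, norm_prod]
    calc ∏ i ∈ Finset.range n, ‖z - x i‖ ≤ ∏ _i ∈ Finset.range n, (R + s) :=
          Finset.prod_le_prod (fun _ _ => norm_nonneg _) fun i _ =>
            (norm_sub_le _ _).trans (add_le_add hz (hx i))
      _ = (R + s) ^ n := by simp
  rw [Polynomial.eval_add]
  linarith [norm_add_le ((polyOfRoots x n).eval z) ((polyOfRoots y n).eval z), h hx, h hy]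

/-- Jensen's formula bounds the mean of `log⁺ |w|` over the zeros of `p + q`. -/
theorem sum_posLog_roots_le {x y : ℕ → ℂ} {s : ℝ} (hs : 0 ≤ s) (hx : ∀ i, ‖x i‖ ≤ s)
    (hy : ∀ i, ‖y i‖ ≤ s) (n : ℕ) :
    ((polyOfRoots x n + polyOfRoots y n).roots.map fun w => Real.posLog ‖w‖).sum ≤
      n * Real.log (1 + s) := by
  set f := polyOfRoots x n + polyOfRoots y n with hf
  have h1 := f.logMahlerMeasure_eq_log_leadingCoeff_add_sum_log_roots
  have h1s : 1 ≤ (1 + s) ^ n := one_le_pow₀ (by linarith)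
  have h2 : f.logMahlerMeasure ≤ Real.log (2 * (1 + s) ^ n) := by
    rw [Polynomial.logMahlerMeasure_def]
    refine Real.circleAverage_mono_on_of_le_circle
      (circleIntegrable_def _ _ _ |>.2 f.intervalIntegrable_mahlerMeasure) fun z hz => ?_
    have hz1 : ‖z‖ ≤ 1 := by
      rw [abs_one, mem_sphere_zero_iff_norm] at hz
      exact hz.le
    have hle := norm_eval_polyOfRoots_add_le hx hy n hz1
    rcases (norm_nonneg (f.eval z)).eq_or_lt with h0 | h0
    · rw [← h0, Real.log_zero]
      exact Real.log_nonneg (by linarith)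
    · exact Real.log_le_log h0 hle
  rw [Real.log_mul two_ne_zero (by positivity), Real.log_pow] at h2
  rw [hf, leadingCoeff_polyOfRoots_add, ← hf, Complex.norm_ofNat] at h1
  linarith

/-- The normalised potentials of the zeros of `p + q` are bounded above on every ball. -/
theorem ae_averageLog_roots_le {x y : ℕ → ℂ} {s R : ℝ} (hs : 0 ≤ s) (hR : 0 ≤ R)
    (hx : ∀ i, ‖x i‖ ≤ s) (hy : ∀ i, ‖y i‖ ≤ s) (n : ℕ) :
    ∀ᵐ z ∂((volume : Measure ℂ).restrict (ball 0 R)),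
      averageLog n (polyOfRoots x n + polyOfRoots y n).roots z ≤ Real.log (1 + R + s) := by
  filter_upwards [ae_restrict_of_ae (ae_eval_ne_zero (polyOfRoots_add_ne_zero x y n)),
    ae_restrict_mem measurableSet_ball] with z hz hzR
  -- The radius `1 + R` instead of `R` makes the logarithm on the right nonnegative.
  have hle := norm_eval_polyOfRoots_add_le (R := 1 + R) hx hy n
    (by rw [mem_ball_zero_iff] at hzR; linarith : ‖z‖ ≤ 1 + R)
  have h2 := Real.log_le_log (norm_pos_iff.2 hz) hle
  rw [Real.log_mul two_ne_zero (by positivity), Real.log_pow] at h2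
  rw [averageLog_roots n hz, leadingCoeff_polyOfRoots_add, Complex.norm_ofNat]
  rcases Nat.eq_zero_or_pos n with rfl | hn
  · simpa using Real.log_nonneg (by linarith)
  · rw [one_div, inv_mul_le_iff₀ (by positivity)]
    linarith

/-! ### Small ball probabilities of random walks -/

/-- Two jointly independent families, paired up index by index, form an independent family. -/
theorem iIndepFun_prodMk_of_sumElim {Ω α : Type*} [MeasurableSpace Ω] [MeasurableSpace α]
    {P : Measure Ω} {X Y : ℕ → Ω → α} (hX : ∀ i, Measurable (X i)) (hY : ∀ i, Measurable (Y i))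
    (h : iIndepFun (Sum.elim X Y) P) : iIndepFun (fun i ξ => (X i ξ, Y i ξ)) P := by
  let π : ℕ → Set (Set Ω) := fun i =>
    (fun S => (fun ξ => (X i ξ, Y i ξ)) ⁻¹' S) ''
      Set.image2 (· ×ˢ ·) {s | MeasurableSet s} {t | MeasurableSet t}
  have hXY (i : ℕ) : Measurable fun ξ => (X i ξ, Y i ξ) := (hX i).prodMk (hY i)
  rw [iIndepFun_iff_iIndep]
  refine iIndepSets.iIndep (fun i => (hXY i).comap_le) π (fun i => ?_) (fun i => ?_) ?_
  · exact isPiSystem_prod.comap _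
  · rw [← generateFrom_prod, MeasurableSpace.comap_generateFrom]
  · rw [iIndepSets_iff]
    intro s f hf
    have hf' : ∀ i, ∃ A B : Set α, i ∈ s → MeasurableSet A ∧ MeasurableSet B ∧
        f i = X i ⁻¹' A ∩ Y i ⁻¹' B := by
      intro i
      by_cases hi : i ∈ s
      · obtain ⟨_, ⟨A, hA, B, hB, rfl⟩, hfi⟩ := hf i hi
        exact ⟨A, B, fun _ => ⟨by simpa using hA, by simpa using hB, hfi.symm⟩⟩
      · exact ⟨∅, ∅, fun h => absurd h hi⟩
    choose A B hAB using hf'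
    have key (t : Finset ℕ) (ht : t ⊆ s) : P (⋂ i ∈ t, f i) =
        ∏ i ∈ t, (P (X i ⁻¹' A i) * P (Y i ⁻¹' B i)) := by
      have h1 := h.measure_inter_preimage_eq_mul (t.disjSum t) (sets := Sum.elim A B) (by
        rintro (i | i) hi
        · exact (hAB i (ht (by simpa using hi))).1
        · exact (hAB i (ht (by simpa using hi))).2.1)
      rw [Finset.prod_disjSum, ← Finset.prod_mul_distrib] at h1
      simp only [Sum.elim_inl, Sum.elim_inr] at h1
      rw [← h1]
      congr 1
      ext ξ
      simp only [Set.mem_iInter, Finset.mem_disjSum]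
      constructor
      · rintro hξ _ (⟨i, hi, rfl⟩ | ⟨i, hi, rfl⟩)
        · have := hξ i hi
          rw [(hAB i (ht hi)).2.2] at this
          exact this.1
        · have := hξ i hi
          rw [(hAB i (ht hi)).2.2] at this
          exact this.2
      · intro hξ i hi
        rw [(hAB i (ht hi)).2.2]
        exact ⟨hξ (Sum.inl i) (Or.inl ⟨i, hi, rfl⟩), hξ (Sum.inr i) (Or.inr ⟨i, hi, rfl⟩)⟩
    rw [key s subset_rfl]
    refine Finset.prod_congr rfl fun i hi => ?_
    simpa using (key {i} (by simpa using hi)).symm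

/-- A random walk with nondegenerate square integrable steps leaves every fixed interval: if the
steps have mean zero, by the central limit theorem, since the Gaussian law has no atoms, and
otherwise by the law of large numbers. -/
theorem tendsto_measure_abs_sum_le_one {Ω : Type*} [MeasurableSpace Ω] {P : Measure Ω}
    [IsProbabilityMeasure P] {W : ℕ → Ω → ℝ} (hW : ∀ i, Measurable (W i)) (hL2 : MemLp (W 0) 2 P)
    (hindep : iIndepFun W P) (hident : ∀ i, IdentDistrib (W i) (W 0) P P)
    (hvar : Var[W 0; P] ≠ 0) :
    Tendsto (fun n : ℕ => P {ξ | |∑ i ∈ Finset.range n, W i ξ| ≤ 1}) atTop (𝓝 0) := by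
  rcases eq_or_ne (∫ ξ, W 0 ξ ∂P) 0 with h0 | h0
  · have hv : Var[W 0; P].toNNReal ≠ 0 := by
      rw [Ne, Real.toNNReal_eq_zero, not_le]
      exact (variance_nonneg _ _).lt_of_ne' hvar
    set γ := gaussianReal 0 Var[W 0; P].toNNReal with hγ
    have hclt := tendstoInDistribution_inv_sqrt_mul_sum_sub (P' := γ) (Y := id) HasLaw.id hL2
      hindep hident
    simp only [h0, mul_zero, sub_zero] at hclt
    have : NullSingletonClass γ := nullSingletonClass_gaussianReal hv
    refine ENNReal.tendsto_nhds_zero.2 fun ε hε => ?_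
    have hball : Tendsto (fun r => γ (cthickening r {(0 : ℝ)})) (𝓝 0) (𝓝 0) := by
      simpa using tendsto_measure_cthickening_of_isClosed (μ := γ) (s := {(0 : ℝ)})
        ⟨1, one_pos, measure_ne_top _ _⟩ isClosed_singleton
    obtain ⟨δ, hδ0, hδ⟩ := ((eventually_mem_nhdsWithin (a := (0 : ℝ)) (s := Set.Ioi 0)).and
      ((hball.mono_left nhdsWithin_le_nhds).eventually_lt_const hε)).exists
    have hδpos : 0 < δ := by simpa using hδ0
    have hle := ProbabilityMeasure.limsup_measure_closed_le_of_tendsto hclt.tendsto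
      (isClosed_cthickening (δ := δ) (E := {(0 : ℝ)}))
    have hlt := eventually_lt_of_limsup_lt (hle.trans_lt (by simpa using hδ))
    -- For `n ≥ 1 / δ²` a sum in `[-1, 1]`, divided by `√n`, lies in `[-δ, δ]`.
    filter_upwards [hlt, eventually_ge_atTop (⌈(1 / δ) ^ 2⌉₊ + 1)] with n hn hn2
    have hmeas : Measurable fun ξ => (√(n : ℝ))⁻¹ * ∑ i ∈ Finset.range n, W i ξ :=
      (Finset.measurable_fun_sum _ fun i _ => hW i).const_mul _
    have hn' : P.map (fun ξ => (√(n : ℝ))⁻¹ * ∑ i ∈ Finset.range n, W i ξ)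
        (cthickening δ {(0 : ℝ)}) < ε := hn
    rw [Measure.map_apply hmeas isClosed_cthickening.measurableSet] at hn'
    refine (measure_mono fun ξ hξ => ?_).trans hn'.le
    have hξ' : |∑ i ∈ Finset.range n, W i ξ| ≤ 1 := by simpa using hξ
    have hnpos : (1 / δ) ^ 2 ≤ (n : ℝ) :=
      (Nat.le_ceil _).trans (by exact_mod_cast (Nat.le_succ _).trans hn2)
    have hsq : 1 / δ ≤ √(n : ℝ) := Real.le_sqrt_of_sq_le hnpos
    have hsq0 : 0 < √(n : ℝ) := lt_of_lt_of_le (by positivity) hsq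
    simp only [Set.mem_preimage, cthickening_singleton _ hδpos.le, mem_closedBall_zero_iff,
      Real.norm_eq_abs, abs_mul, abs_inv, abs_of_pos hsq0]
    rw [inv_mul_le_iff₀ hsq0]
    refine hξ'.trans ?_
    rwa [div_le_iff₀ hδpos] at hsq
  · have hslln := strong_law_ae_real W (hL2.integrable one_le_two)
      (fun i j hij => hindep.indepFun hij) hident
    have hmeas (n : ℕ) : Measurable fun ξ => (∑ i ∈ Finset.range n, W i ξ) / n :=
      (Finset.measurable_fun_sum _ fun i _ => hW i).div_const _
    have hin := tendstoInMeasure_of_tendsto_ae (fun n => (hmeas n).aestronglyMeasurable) hslln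
    rw [tendstoInMeasure_iff_norm] at hin
    set m := ∫ ξ, W 0 ξ ∂P with hm
    have hm0 : 0 < |m| := abs_pos.2 h0
    refine tendsto_of_tendsto_of_tendsto_of_le_of_le' tendsto_const_nhds
      (hin (|m| / 2) (by positivity)) (Eventually.of_forall fun _ => zero_le) ?_
    -- For `n ≥ 2 / |m|` a sum in `[-1, 1]`, divided by `n`, is at distance `|m| / 2` from `m`.
    filter_upwards [eventually_ge_atTop (⌈2 / |m|⌉₊ + 1)] with n hn
    refine measure_mono fun ξ hξ => ?_
    have hξ' : |∑ i ∈ Finset.range n, W i ξ| ≤ 1 := by simpa using hξ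
    have hn1 : 2 / |m| ≤ (n : ℝ) :=
      (Nat.le_ceil _).trans (by exact_mod_cast (Nat.le_succ _).trans hn)
    have hnpos : (0 : ℝ) < n := lt_of_lt_of_le (by positivity) hn1
    have h3 : |(∑ i ∈ Finset.range n, W i ξ) / n| ≤ |m| / 2 := by
      rw [abs_div, abs_of_pos hnpos, div_le_iff₀ hnpos]
      rw [div_le_iff₀ hm0] at hn1
      linarith
    have h4 := abs_sub_abs_le_abs_sub m ((∑ i ∈ Finset.range n, W i ξ) / n)
    simp only [Set.mem_ofPred_eq, Real.norm_eq_abs]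
    rw [abs_sub_comm]
    linarith

/-! ### Pointwise convergence in probability -/

/-- If the moduli of `a` and `b` differ by a factor larger than `e`, then `a + b` has the size of
the larger term up to a factor of at most `e`. -/
theorem abs_log_norm_add_sub_max_le {a b : ℂ} (ha : a ≠ 0) (hb : b ≠ 0)
    (h : 1 < |Real.log ‖a‖ - Real.log ‖b‖|) :
    |Real.log ‖a + b‖ - max (Real.log ‖a‖) (Real.log ‖b‖)| ≤ 1 := by
  wlog hab : Real.log ‖b‖ ≤ Real.log ‖a‖ generalizing a b
  · rw [add_comm, max_comm]
    exact this hb ha (by rwa [abs_sub_comm]) (le_of_not_ge hab)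
  have ha0 : 0 < ‖a‖ := norm_pos_iff.2 ha
  have hb0 : 0 < ‖b‖ := norm_pos_iff.2 hb
  rw [abs_of_nonneg (by linarith)] at h
  rw [max_eq_left hab]
  have hl2 : Real.log 2 ≤ 1 := by linarith [Real.log_two_lt_d9]
  have hba : 2 * ‖b‖ ≤ ‖a‖ := by
    rw [← Real.log_le_log_iff (by positivity) ha0, Real.log_mul two_ne_zero hb0.ne']
    linarith
  have h1 : ‖a‖ / 2 ≤ ‖a + b‖ := by
    have := norm_sub_le (a + b) b
    rw [add_sub_cancel_right] at this
    linarith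
  have h2 : ‖a + b‖ ≤ 2 * ‖a‖ := by linarith [norm_add_le a b]
  have h3 := Real.log_le_log (by positivity) h1
  have h4 := Real.log_le_log (lt_of_lt_of_le (by positivity) h1) h2
  rw [Real.log_div ha0.ne' two_ne_zero] at h3
  rw [Real.log_mul two_ne_zero ha0.ne'] at h4
  rw [abs_le]
  constructor <;> linarith

/-- `(1 / n) (log |(p + q)(z)| - log 2)`, the normalised potential of the zeros of `p + q` (which
has leading coefficient `2`) away from these zeros. -/
noncomputable def sumPotential (x y : ℕ → ℂ) (n : ℕ) (z : ℂ) : ℝ :=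
  (1 / (n : ℝ)) * (Real.log ‖(polyOfRoots x n + polyOfRoots y n).eval z‖ - Real.log 2)

theorem averageLog_roots_eq_sumPotential (x y : ℕ → ℂ) (n : ℕ) :
    ∀ᵐ z : ℂ, averageLog n (polyOfRoots x n + polyOfRoots y n).roots z = sumPotential x y n z := by
  filter_upwards [ae_eval_ne_zero (polyOfRoots_add_ne_zero x y n)] with z hz
  rw [averageLog_roots n hz, leadingCoeff_polyOfRoots_add, Complex.norm_ofNat, sumPotential]

theorem measurable_sumPotential {Ω : Type*} [MeasurableSpace Ω] {X Y : ℕ → Ω → ℂ}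
    (hX : ∀ i, Measurable (X i)) (hY : ∀ i, Measurable (Y i)) (n : ℕ) :
    Measurable fun p : Ω × ℂ => sumPotential (fun i => X i p.1) (fun i => Y i p.1) n p.2 := by
  simp only [sumPotential, Polynomial.eval_add, eval_polyOfRoots]
  have h {X : ℕ → Ω → ℂ} (hX : ∀ i, Measurable (X i)) :
      Measurable fun p : Ω × ℂ => ∏ i ∈ Finset.range n, (p.2 - X i p.1) :=
    Finset.measurable_fun_prod _ fun i _ => measurable_snd.sub ((hX i).comp measurable_fst)
  exact ((((h hX).add (h hY)).norm.log).sub_const _).const_mul _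

/-- The only use of the hypothesis on circles: if `log |z - w|` were almost surely constant, then
`μ` would be supported on a circle around `z`. -/
theorem variance_log_norm_sub_ne_zero {μ : Measure ℂ} [IsProbabilityMeasure μ]
    (hcirc : ¬ SupportedOnCircle μ) {z : ℂ} (hz : IsRegularPoint μ z) :
    Var[fun w => Real.log ‖z - w‖; μ] ≠ 0 := by
  intro h0
  have h1 := ae_eq_integral_of_variance_eq_zero hz.2 h0
  refine hcirc ⟨z, Real.exp (∫ w, Real.log ‖z - w‖ ∂μ), (Real.exp_pos _).le, ?_⟩
  refine Measure.support_subset_of_isClosed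
    (isClosed_eq (by fun_prop) continuous_const) ?_
  filter_upwards [h1, hz.ae_ne] with w hw hwz
  rw [← hw, Real.exp_log (norm_pos_iff.2 (sub_ne_zero.2 hwz.symm)), norm_sub_rev]

theorem identDistrib_of_map_eq {Ω : Type*} [MeasurableSpace Ω] {P : Measure Ω} {μ : Measure ℂ}
    {X : ℕ → Ω → ℂ} (hX : ∀ i, Measurable (X i)) (hXμ : ∀ i, P.map (X i) = μ) (i : ℕ) :
    IdentDistrib (X i) (X 0) P P :=
  ⟨(hX i).aemeasurable, (hX 0).aemeasurable, by rw [hXμ, hXμ]⟩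

theorem tendsto_sum_log_div {Ω : Type*} [MeasurableSpace Ω] {P : Measure Ω} {μ : Measure ℂ}
    [IsProbabilityMeasure μ] {X : ℕ → Ω → ℂ} (hX : ∀ i, Measurable (X i))
    (hXμ : ∀ i, P.map (X i) = μ) (hindep : iIndepFun X P) {z : ℂ} (hz : IsRegularPoint μ z) :
    ∀ᵐ ξ ∂P, Tendsto (fun n : ℕ => (∑ i ∈ Finset.range n, Real.log ‖z - X i ξ‖) / n) atTop
      (𝓝 (realPotential μ z)) := by
  have hg : Measurable fun w : ℂ => Real.log ‖z - w‖ := by fun_prop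
  have hint : Integrable (fun ξ => Real.log ‖z - X 0 ξ‖) P := by
    have := hz.integrable
    rw [← hXμ 0] at this
    exact this.comp_measurable (hX 0)
  have h := strong_law_ae_real (fun i ξ => Real.log ‖z - X i ξ‖) hint
    (fun i j hij => (hindep.indepFun hij).comp hg hg)
    (fun i => (identDistrib_of_map_eq hX hXμ i).comp hg)
  have he : ∫ ξ, Real.log ‖z - X 0 ξ‖ ∂P = realPotential μ z := by
    rw [realPotential, ← hXμ 0, integral_map (hX 0).aemeasurable hg.aestronglyMeasurable]
  rwa [he] at h

theorem ae_forall_ne_of_isRegularPoint {Ω : Type*} [MeasurableSpace Ω] {P : Measure Ω}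
    {μ : Measure ℂ} {X : ℕ → Ω → ℂ} (hX : ∀ i, Measurable (X i))
    (hXμ : ∀ i, P.map (X i) = μ)
    {z : ℂ} (hz : IsRegularPoint μ z) : ∀ᵐ ξ ∂P, ∀ i, X i ξ ≠ z := by
  refine ae_all_iff.2 fun i => ?_
  have := hz.ae_ne
  rw [← hXμ i] at this
  exact ae_of_ae_map (hX i).aemeasurable this

section Random

variable {Ω : Type*} [MeasurableSpace Ω] {P : Measure Ω} [IsProbabilityMeasure P]
  {μ ν : Measure ℂ} [IsProbabilityMeasure μ] {X Y : ℕ → Ω → ℂ}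

theorem tendsto_measure_abs_sum_log_sub_le_one (hX : ∀ i, Measurable (X i))
    (hY : ∀ i, Measurable (Y i)) (hXμ : ∀ i, P.map (X i) = μ) (hYν : ∀ i, P.map (Y i) = ν)
    (hindep : iIndepFun (Sum.elim X Y) P) (hcirc : ¬ SupportedOnCircle μ) {z : ℂ}
    (hzμ : IsRegularPoint μ z) (hzν : IsRegularPoint ν z) :
    Tendsto (fun n : ℕ => P {ξ | |∑ i ∈ Finset.range n,
      (Real.log ‖z - X i ξ‖ - Real.log ‖z - Y i ξ‖)| ≤ 1}) atTop (𝓝 0) := by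
  have hg : Measurable fun w : ℂ => Real.log ‖z - w‖ := by fun_prop
  have hg2 : Measurable fun p : ℂ × ℂ => Real.log ‖z - p.1‖ - Real.log ‖z - p.2‖ := by fun_prop
  have hpair := iIndepFun_prodMk_of_sumElim hX hY hindep
  have hXY (i : ℕ) : IndepFun (X i) (Y i) P :=
    hindep.indepFun (i := Sum.inl i) (j := Sum.inr i) (by simp)
  have hA : MemLp (fun ξ => Real.log ‖z - X 0 ξ‖) 2 P := by
    have := hzμ.2
    rw [← hXμ 0] at this
    exact this.comp_of_map (hX 0).aemeasurable
  have hB : MemLp (fun ξ => -Real.log ‖z - Y 0 ξ‖) 2 P := by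
    have := hzν.2
    rw [← hYν 0] at this
    exact (this.comp_of_map (hY 0).aemeasurable).neg
  have hident (i : ℕ) : IdentDistrib (fun ξ => (X i ξ, Y i ξ)) (fun ξ => (X 0 ξ, Y 0 ξ)) P P := by
    refine ⟨((hX i).prodMk (hY i)).aemeasurable, ((hX 0).prodMk (hY 0)).aemeasurable, ?_⟩
    rw [(indepFun_iff_map_prod_eq_prod_map_map (hX i).aemeasurable (hY i).aemeasurable).1 (hXY i),
      (indepFun_iff_map_prod_eq_prod_map_map (hX 0).aemeasurable (hY 0).aemeasurable).1 (hXY 0),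
      hXμ, hXμ, hYν, hYν]
  refine tendsto_measure_abs_sum_le_one
    (W := fun i ξ => Real.log ‖z - X i ξ‖ - Real.log ‖z - Y i ξ‖)
    (fun i => hg2.comp ((hX i).prodMk (hY i))) ?_ (hpair.comp (fun _ => _) fun _ => hg2)
    (fun i => (hident i).comp hg2) ?_
  · exact (hA.add hB).ae_eq (Eventually.of_forall fun ξ => (sub_eq_add_neg _ _).symm)
  · have hsum : Var[fun ξ => Real.log ‖z - X 0 ξ‖ - Real.log ‖z - Y 0 ξ‖; P] =
        Var[fun ξ => Real.log ‖z - X 0 ξ‖; P] + Var[fun ξ => -Real.log ‖z - Y 0 ξ‖; P] := by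
      rw [← IndepFun.variance_add hA hB ((hXY 0).comp hg hg.neg)]
      simp only [sub_eq_add_neg]
      rfl
    have hVX : Var[fun ξ => Real.log ‖z - X 0 ξ‖; P] = Var[fun w => Real.log ‖z - w‖; μ] := by
      rw [← hXμ 0, variance_map hg.aemeasurable (hX 0).aemeasurable]
      rfl
    have h1 : 0 < Var[fun ξ => Real.log ‖z - X 0 ξ‖; P] := by
      rw [hVX]
      exact (variance_nonneg _ _).lt_of_ne' (variance_log_norm_sub_ne_zero hcirc hzμ)
    have h2 := variance_nonneg (fun ξ => -Real.log ‖z - Y 0 ξ‖) P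
    linarith

/-- At regular points `(1 / n) log |p_n + q_n|` converges in probability to the maximum of the
potentials: the two terms cannot cancel, because `log |p_n| - log |q_n|` is unlikely to be small. -/
theorem tendstoInMeasure_sumPotential [IsProbabilityMeasure ν] (hX : ∀ i, Measurable (X i))
    (hY : ∀ i, Measurable (Y i))
    (hXμ : ∀ i, P.map (X i) = μ) (hYν : ∀ i, P.map (Y i) = ν)
    (hindep : iIndepFun (Sum.elim X Y) P) (hcirc : ¬ SupportedOnCircle μ) {z : ℂ}
    (hzμ : IsRegularPoint μ z) (hzν : IsRegularPoint ν z) :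
    TendstoInMeasure P (fun n ξ => sumPotential (fun i => X i ξ) (fun i => Y i ξ) n z) atTop
      (fun _ => max (realPotential μ z) (realPotential ν z)) := by
  set a : ℕ → Ω → ℝ := fun n ξ => ∑ i ∈ Finset.range n, Real.log ‖z - X i ξ‖ with hadef
  set b : ℕ → Ω → ℝ := fun n ξ => ∑ i ∈ Finset.range n, Real.log ‖z - Y i ξ‖ with hbdef
  have hm {X : ℕ → Ω → ℂ} (hX : ∀ i, Measurable (X i)) (n : ℕ) :
      Measurable fun ξ => ∑ i ∈ Finset.range n, Real.log ‖z - X i ξ‖ :=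
    Finset.measurable_fun_sum _ fun i _ => (measurable_const.sub (hX i)).norm.log
  have hM : TendstoInMeasure P (fun n ξ => max (a n ξ / n) (b n ξ / n)) atTop
      (fun _ => max (realPotential μ z) (realPotential ν z)) := by
    refine tendstoInMeasure_of_tendsto_ae (fun n => ?_) ?_
    · exact (((hm hX n).div_const _).max ((hm hY n).div_const _)).aestronglyMeasurable
    · filter_upwards [
        tendsto_sum_log_div hX hXμ (hindep.precomp (g := Sum.inl) Sum.inl_injective) hzμ,
        tendsto_sum_log_div hY hYν (hindep.precomp (g := Sum.inr) Sum.inr_injective) hzν]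
        with ξ h1 h2
      exact h1.max h2
  have hsmall := tendsto_measure_abs_sum_log_sub_le_one hX hY hXμ hYν hindep hcirc hzμ hzν
  rw [tendstoInMeasure_iff_norm] at hM ⊢
  intro ε hε
  have hlim := (hM (ε / 2) (by positivity)).add hsmall
  rw [add_zero] at hlim
  refine tendsto_of_tendsto_of_tendsto_of_le_of_le' tendsto_const_nhds hlim
    (Eventually.of_forall fun _ => zero_le) ?_
  -- Without cancellation `n u_n` is within `1 + log 2 ≤ 2` of the maximum, and `2 / n ≤ ε / 2`.
  filter_upwards [eventually_ge_atTop (⌈4 / ε⌉₊ + 1)] with n hn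
  refine le_trans (measure_mono_ae ?_) (measure_union_le _ _)
  filter_upwards [ae_forall_ne_of_isRegularPoint hX hXμ hzμ,
    ae_forall_ne_of_isRegularPoint hY hYν hzν] with ξ hXξ hYξ hξ
  by_contra hcon
  have hcon' : ¬ (ε / 2 ≤ |max (a n ξ / n) (b n ξ / n) -
      max (realPotential μ z) (realPotential ν z)| ∨
      |∑ i ∈ Finset.range n, (Real.log ‖z - X i ξ‖ - Real.log ‖z - Y i ξ‖)| ≤ 1) := hcon
  have hξ' : ε ≤ |sumPotential (fun i => X i ξ) (fun i => Y i ξ) n z -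
      max (realPotential μ z) (realPotential ν z)| := hξ
  rw [not_or, not_le, not_le, Finset.sum_sub_distrib] at hcon'
  obtain ⟨hc1, hc2⟩ := hcon'
  have hn1 : 4 / ε ≤ (n : ℝ) :=
    (Nat.le_ceil _).trans (by exact_mod_cast (Nat.le_succ _).trans hn)
  have hnpos : (0 : ℝ) < n := lt_of_lt_of_le (by positivity) hn1
  have hlog {x : ℕ → ℂ} (hx : ∀ i, x i ≠ z) : (polyOfRoots x n).eval z ≠ 0 ∧
      Real.log ‖(polyOfRoots x n).eval z‖ = ∑ i ∈ Finset.range n, Real.log ‖z - x i‖ := by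
    have h0 (i : ℕ) : z - x i ≠ 0 := sub_ne_zero.2 (hx i).symm
    rw [eval_polyOfRoots, norm_prod, Real.log_prod fun i _ => norm_ne_zero_iff.2 (h0 i)]
    exact ⟨Finset.prod_ne_zero_iff.2 fun i _ => h0 i, rfl⟩
  obtain ⟨hp0, hp⟩ := hlog hXξ
  obtain ⟨hq0, hq⟩ := hlog hYξ
  have hkey := abs_log_norm_add_sub_max_le hp0 hq0 (by rw [hp, hq]; exact hc2)
  rw [hp, hq, ← Polynomial.eval_add] at hkey
  have hmax : max (a n ξ / n) (b n ξ / n) = (1 / (n : ℝ)) * max (a n ξ) (b n ξ) := by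
    rw [max_div_div_right hnpos.le]; ring
  have hdiff : |sumPotential (fun i => X i ξ) (fun i => Y i ξ) n z -
      max (a n ξ / n) (b n ξ / n)| ≤ ε / 2 := by
    rw [hmax, sumPotential, ← mul_sub, abs_mul, abs_of_pos (by positivity : 0 < 1 / (n : ℝ)),
      one_div, inv_mul_le_iff₀ hnpos]
    have hl2 : Real.log 2 ≤ 1 := by linarith [Real.log_two_lt_d9]
    have hl0 : 0 ≤ Real.log 2 := Real.log_nonneg one_le_two
    have h5 : 2 ≤ n * (ε / 2) := by
      rw [div_le_iff₀ hε] at hn1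
      linarith
    refine le_trans ?_ h5
    rw [abs_le] at hkey ⊢
    simp only [hadef, hbdef]
    constructor <;> linarith [hkey.1, hkey.2]
  have := abs_sub_le (sumPotential (fun i => X i ξ) (fun i => Y i ξ) n z)
    (max (a n ξ / n) (b n ξ / n)) (max (realPotential μ z) (realPotential ν z))
  linarith

end Random

/-! ### Global convergence -/

theorem ae_forall_norm_le {Ω : Type*} [MeasurableSpace Ω] {P : Measure Ω} {μ : Measure ℂ}
    {X : ℕ → Ω → ℂ} {s : ℝ} (hμ : ∀ᵐ w ∂μ, ‖w‖ ≤ s) (hX : ∀ i, Measurable (X i))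
    (hXμ : ∀ i, P.map (X i) = μ) : ∀ᵐ ξ ∂P, ∀ i, ‖X i ξ‖ ≤ s :=
  ae_all_iff.2 fun i => ae_of_ae_map (hX i).aemeasurable ((hXμ i).symm ▸ hμ)

theorem aestronglyMeasurable_zeroAverage {Ω : Type*} [MeasurableSpace Ω] {P : Measure Ω}
    {X Y : ℕ → Ω → ℂ} (hX : ∀ i, Measurable (X i)) (hY : ∀ i, Measurable (Y i))
    {φ : ℂ → ℂ} (hφ : ContDiff ℝ ∞ φ) (hc : HasCompactSupport φ) (n : ℕ) :
    AEStronglyMeasurable (fun ξ => zeroAverage φ n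
      (polyOfRoots (fun i => X i ξ) n + polyOfRoots (fun i => Y i ξ) n)) P := by
  have h1 : StronglyMeasurable fun ξ => (1 / (2 * (Real.pi : ℂ))) *
      ∫ z : ℂ, Laplacian.laplacian φ z *
        (sumPotential (fun i => X i ξ) (fun i => Y i ξ) n z : ℂ) := by
    refine StronglyMeasurable.const_mul ?_ _
    refine StronglyMeasurable.integral_prod_right' (f := fun p : Ω × ℂ =>
      Laplacian.laplacian φ p.2 * (sumPotential (fun i => X i p.1) (fun i => Y i p.1) n p.2 : ℂ)) ?_
    exact (((continuous_laplacian hφ).measurable.comp measurable_snd).mul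
      (Complex.measurable_ofReal.comp (measurable_sumPotential hX hY n))).stronglyMeasurable
  refine h1.aestronglyMeasurable.congr (Eventually.of_forall fun ξ => ?_)
  simp only
  rw [zeroAverage_eq_integral hφ hc]
  congr 1
  refine integral_congr_ae ?_
  filter_upwards [averageLog_roots_eq_sumPotential (fun i => X i ξ) (fun i => Y i ξ) n] with z hz
  rw [hz]

section Random

variable {Ω : Type*} [MeasurableSpace Ω] {P : Measure Ω} [IsProbabilityMeasure P]
  {μ ν : Measure ℂ} [IsProbabilityMeasure μ] [IsProbabilityMeasure ν] {X Y : ℕ → Ω → ℂ}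

/-- Convergence in probability at almost every point becomes, by Fubini's theorem, convergence in
measure on the product space, with a finite measure equivalent to Lebesgue measure. -/
theorem tendstoInMeasure_prod_sumPotential {s : ℝ} (hμ : ∀ᵐ w ∂μ, ‖w‖ ≤ s)
    (hν : ∀ᵐ w ∂ν, ‖w‖ ≤ s) (hX : ∀ i, Measurable (X i)) (hY : ∀ i, Measurable (Y i))
    (hXμ : ∀ i, P.map (X i) = μ) (hYν : ∀ i, P.map (Y i) = ν)
    (hindep : iIndepFun (Sum.elim X Y) P) (hcirc : ¬ SupportedOnCircle μ) :
    TendstoInMeasure (P.prod (volume : Measure ℂ).toFinite)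
      (fun n p => sumPotential (fun i => X i p.1) (fun i => Y i p.1) n p.2) atTop
      (fun p => max (realPotential μ p.2) (realPotential ν p.2)) := by
  rw [tendstoInMeasure_iff_norm]
  intro ε hε
  have hV : Measurable fun z : ℂ => max (realPotential μ z) (realPotential ν z) :=
    (stronglyMeasurable_realPotential μ).measurable.max
      (stronglyMeasurable_realPotential ν).measurable
  have hS (n : ℕ) : MeasurableSet {p : Ω × ℂ |
      ε ≤ ‖sumPotential (fun i => X i p.1) (fun i => Y i p.1) n p.2 -
        max (realPotential μ p.2) (realPotential ν p.2)‖} :=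
    measurableSet_le measurable_const
      ((measurable_sumPotential hX hY n).sub (hV.comp measurable_snd)).norm
  simp_rw [Measure.prod_apply_symm (hS _)]
  rw [← lintegral_zero (μ := (volume : Measure ℂ).toFinite)]
  refine tendsto_lintegral_of_dominated_convergence (fun _ => 1)
    (fun n => measurable_measure_prodMk_right (hS n))
    (fun n => Eventually.of_forall fun z => prob_le_one) (by simp) ?_
  rw [ae_toFinite]
  filter_upwards [ae_isRegularPoint hμ, ae_isRegularPoint hν] with z h1 h2
  exact tendstoInMeasure_iff_norm.1
    (tendstoInMeasure_sumPotential hX hY hXμ hYν hindep hcirc h1 h2) ε hε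

/-- Along a further subsequence, almost surely, the zero averages of all test functions converge
simultaneously. -/
theorem exists_subseq_ae_tendsto_zeroAverage {s : ℝ} (hs : 0 ≤ s) (hμ : ∀ᵐ w ∂μ, ‖w‖ ≤ s)
    (hν : ∀ᵐ w ∂ν, ‖w‖ ≤ s) (hX : ∀ i, Measurable (X i)) (hY : ∀ i, Measurable (Y i))
    (hXμ : ∀ i, P.map (X i) = μ) (hYν : ∀ i, P.map (Y i) = ν)
    (hindep : iIndepFun (Sum.elim X Y) P) (hcirc : ¬ SupportedOnCircle μ)
    {ns : ℕ → ℕ} (hns : StrictMono ns) :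
    ∃ ns' : ℕ → ℕ, StrictMono ns' ∧ ∀ᵐ ξ ∂P, ∀ φ : ℂ → ℂ, ContDiff ℝ ∞ φ → HasCompactSupport φ →
      Tendsto (fun k => zeroAverage φ (ns (ns' k))
        (polyOfRoots (fun i => X i ξ) (ns (ns' k)) + polyOfRoots (fun i => Y i ξ) (ns (ns' k))))
        atTop (𝓝 ((1 / (2 * (Real.pi : ℂ))) * ∫ z : ℂ, Laplacian.laplacian φ z *
          ((max (realPotential μ z) (realPotential ν z) : ℝ) : ℂ))) := by
  obtain ⟨ns', hns', hae⟩ := ((tendstoInMeasure_prod_sumPotential hμ hν hX hY hXμ hYν hindep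
    hcirc).comp hns.tendsto_atTop).exists_seq_tendsto_ae
  refine ⟨ns', hns', ?_⟩
  filter_upwards [Measure.ae_ae_of_ae_prod hae, ae_forall_norm_le hμ hX hXμ,
    ae_forall_norm_le hν hY hYν] with ξ hξ hXs hYs φ hφ hc
  rw [ae_toFinite] at hξ
  simp_rw [zeroAverage_eq_integral hφ hc]
  refine Tendsto.const_mul _ ?_
  refine tendsto_integral_mul_averageLog
    (fun k => (card_roots_polyOfRoots_add _ _ _).le) (fun R => ?_)
    (locallyIntegrable_max_realPotential hμ hν) ?_ (continuous_laplacian hφ)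
    (hasCompactSupport_laplacian hφ hc)
  · refine ⟨Real.log (1 + max R 0 + s), fun k => ?_⟩
    exact ae_mono (Measure.restrict_mono (ball_subset_ball (le_max_left R 0)) le_rfl)
      (ae_averageLog_roots_le hs (le_max_right R 0) hXs hYs _)
  · have h2 : ∀ᵐ z : ℂ, ∀ n, averageLog n (polyOfRoots (fun i => X i ξ) n +
        polyOfRoots (fun i => Y i ξ) n).roots z =
        sumPotential (fun i => X i ξ) (fun i => Y i ξ) n z :=
      ae_all_iff.2 fun n => averageLog_roots_eq_sumPotential _ _ n
    filter_upwards [hξ, h2] with z hz hz2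
    simp_rw [hz2]
    exact hz

end Random

/-- The limiting measure is a weak limit of the zero distributions along one realisation. -/
theorem exists_isProbabilityMeasure_integral_eq {μ ν : Measure ℂ} [IsProbabilityMeasure μ]
    [IsProbabilityMeasure ν] {s : ℝ} (hs : 0 ≤ s) (hμ : ∀ᵐ w ∂μ, ‖w‖ ≤ s)
    (hν : ∀ᵐ w ∂ν, ‖w‖ ≤ s) (hcirc : ¬ SupportedOnCircle μ) :
    ∃ ρ : Measure ℂ, IsProbabilityMeasure ρ ∧
      ∀ φ : ℂ → ℂ, ContDiff ℝ ∞ φ → HasCompactSupport φ →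
        ∫ z, φ z ∂ρ = (1 / (2 * (Real.pi : ℂ))) * ∫ z : ℂ, Laplacian.laplacian φ z *
          ((max (realPotential μ z) (realPotential ν z) : ℝ) : ℂ) := by
  have : ∀ i, IsProbabilityMeasure (Sum.elim (fun _ : ℕ => μ) (fun _ : ℕ => ν) i) := by
    rintro (i | i) <;> simpa
  obtain ⟨Ω, mΩ, P, Z, hZ, hlaw, hindep, hP⟩ := exists_hasLaw_indepFun (fun _ : ℕ ⊕ ℕ => ℂ)
    (Sum.elim (fun _ : ℕ => μ) (fun _ : ℕ => ν))
  have hZ' : Sum.elim (fun i => Z (Sum.inl i)) (fun i => Z (Sum.inr i)) = Z :=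
    Sum.elim_comp_inl_inr Z
  have hXμ : ∀ i, P.map (Z (Sum.inl i)) = μ := fun i => (hlaw (Sum.inl i)).map_eq
  have hYν : ∀ i, P.map (Z (Sum.inr i)) = ν := fun i => (hlaw (Sum.inr i)).map_eq
  have hX : ∀ i, Measurable (Z (Sum.inl i)) := fun i => hZ _
  have hY : ∀ i, Measurable (Z (Sum.inr i)) := fun i => hZ _
  -- Starting at `n = 1`, since a polynomial without zeros has no zero distribution.
  obtain ⟨ns', hns', hae⟩ := exists_subseq_ae_tendsto_zeroAverage (P := P) hs hμ hν hX hY hXμ hYν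
    (hZ'.symm ▸ hindep) hcirc (ns := fun k => k + 1) (strictMono_id.add_const 1)
  obtain ⟨ξ, hξ, hXs, hYs⟩ := (hae.and ((ae_forall_norm_le hμ hX hXμ).and
    (ae_forall_norm_le hν hY hYν))).exists
  obtain ⟨ρ, hρ, ms, hms, hlim⟩ := exists_subseq_tendsto_empiricalMeasure
    (n := fun k => ns' k + 1) (fun k => Nat.succ_pos _)
    (fun k => card_roots_polyOfRoots_add (fun i => Z (Sum.inl i) ξ) (fun i => Z (Sum.inr i) ξ) _)
    (fun k => sum_posLog_roots_le hs hXs hYs _)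
  refine ⟨ρ, hρ, fun φ hφ hc => ?_⟩
  exact tendsto_nhds_unique (hlim φ hφ.continuous hc)
    ((hξ φ hφ hc).comp hms.tendsto_atTop)

theorem mainTheorem1 (μ ν : Measure ℂ) [IsProbabilityMeasure μ] [IsProbabilityMeasure ν]
    (hμ : IsCompact μ.support) (hν : IsCompact ν.support) (hcirc : ¬ SupportedOnCircle μ) :
    ∃ ρ : Measure ℂ, IsProbabilityMeasure ρ ∧
      IsDistributionalLaplacian ρ (fun z => max (logPotential μ z) (logPotential ν z)) ∧
      (∀ ρ' : Measure ℂ, IsLocallyFiniteMeasure ρ' →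
        IsDistributionalLaplacian ρ' (fun z => max (logPotential μ z) (logPotential ν z)) →
        ρ' = ρ) ∧
      ∀ (Ω : Type*) (mΩ : MeasurableSpace Ω) (P : Measure Ω), IsProbabilityMeasure P →
        ∀ X Y : ℕ → Ω → ℂ,
        (∀ i, Measurable (X i)) → (∀ i, Measurable (Y i)) →
        (∀ i, P.map (X i) = μ) → (∀ i, P.map (Y i) = ν) →
        iIndepFun (Sum.elim X Y) P →
        ∀ φ : ℂ → ℂ, ContDiff ℝ ∞ φ → HasCompactSupport φ →
          TendstoInMeasure P
            (fun (n : ℕ) (w : Ω) =>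
              zeroAverage φ n
                (polyOfRoots (fun i => X i w) n + polyOfRoots (fun i => Y i w) n))
            atTop (fun _ => ∫ z, φ z ∂ρ) := by
  obtain ⟨s₁, hs₁, hμ₁⟩ := ae_norm_le_of_isCompact_support hμ
  obtain ⟨s₂, -, hν₂⟩ := ae_norm_le_of_isCompact_support hν
  have hs : 0 ≤ max s₁ s₂ := hs₁.trans (le_max_left _ _)
  have hμs : ∀ᵐ w ∂μ, ‖w‖ ≤ max s₁ s₂ := hμ₁.mono fun w hw => hw.trans (le_max_left _ _)
  have hνs : ∀ᵐ w ∂ν, ‖w‖ ≤ max s₁ s₂ := hν₂.mono fun w hw => hw.trans (le_max_right _ _)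
  obtain ⟨ρ, hρ, hρeq⟩ := exists_isProbabilityMeasure_integral_eq hs hμs hνs hcirc
  have hU := max_logPotential_eq_ae hμs hνs
  have hlap : IsDistributionalLaplacian ρ
      (fun z => max (logPotential μ z) (logPotential ν z)) := by
    refine ⟨hU.mono fun z hz => ?_, ?_, fun φ hφ hc => ?_⟩
    · simp only [hz]
      exact ⟨EReal.coe_ne_bot _, EReal.coe_ne_top _⟩
    · refine (locallyIntegrable_max_realPotential hμs hνs).congr ?_
      filter_upwards [hU] with z hz
      rw [hz, EReal.toReal_coe]
    · rw [hρeq φ hφ hc]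
      congr 1
      refine integral_congr_ae ?_
      filter_upwards [hU] with z hz
      rw [hz, EReal.toReal_coe]
  refine ⟨ρ, hρ, hlap, fun ρ' hρ' h => ?_, ?_⟩
  · exact measure_ext_of_integral_contDiff fun φ hφ hc =>
      (h.2.2 φ hφ hc).trans (hlap.2.2 φ hφ hc).symm
  · intro Ω mΩ P hP X Y hX hY hXμ hYν hindep φ hφ hc
    rw [exists_seq_tendstoInMeasure_atTop_iff
      (fun n => aestronglyMeasurable_zeroAverage hX hY hφ hc n)]
    intro ns hns
    obtain ⟨ns', hns', h⟩ := exists_subseq_ae_tendsto_zeroAverage hs hμs hνs hX hY hXμ hYν hindep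
      hcirc hns
    refine ⟨ns', hns', h.mono fun ξ hξ => ?_⟩
    rw [hρeq φ hφ hc]
    exact hξ φ hφ hc
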